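/- Model. Group $i$ ($i=1,2,\dots$) has population $s_i\in[0,\bar s]$ and voting weight $a(s_i)$, where the weight allocation $a:[0,\bar s]\to[0,\bar a]$ is Borel measurable. The empirical distributions $\Psi^n$ of $s_1,\dots,s_n$ converge weakly, as $n\to\infty$, to a probability distribution $\Psi^*$ on $[0,\bar s]$ that is not degenerate at $0$. The function $r:[-1,1]\to[-1,1]$ is nondecreasing, odd and not identically zero. The vote margins $X_1,X_2,\dots$ are i.i.d. random variables with values in $[-1,1]$ whose common distribution is nondegenerate and symmetric about $0$. In the society of the first $n$ groups put $$S=\sum_{i\le n}s_iX_i,\qquad T=\sum_{i\le n}a(s_i)r(X_i),\qquad \sigma=\sqrt{\mathbf E[X_1^2]\textstyle\sum_{i\le n}s_i^2},$$ let the social decision $D$ be the sign of $T$ if $T\ne0$ and the outcome $\pm1$ of a fair coin independent of the $X_i$ if $T=0$, and let welfare be $W=DS/\sigma$. Put $$u(a)=\mathbf E[W],\qquad \delta(a)=\tfrac12\mathbf E\Big[\frac{|S|}{\sigma}-W\Big],\qquad p(a)=\mathbf P\{W<0\},$$ $$\rho=\frac{\mathbf E[X_1r(X_1)]}{\sqrt{\mathbf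 E[X_1^2]\,\mathbf E[r(X_1)^2]}},\qquad c(a)=\frac{\sum_{i\le n}s_ia(s_i)}{\sqrt{\sum_{i\le n}s_i^2\,\sum_{i\le n}a(s_i)^2}}$$ (a quotient with denominator $0$ is read as $0$). Corollary. Let $a$ be a weight allocation for which the asymptotic cosine proportionality $c^*(a)=\lim_{n\to\infty}c(a)$ exists. Then, as $n\to\infty$, (i) $u(a)\to\sqrt{2/\pi}\;\rho\,c^*(a)$; (ii) $\delta(a)\to\dfrac{1-\rho\,c^*(a)}{\sqrt{2\pi}}$; (iii) $p(a)\to\dfrac{\arccos(\rho\,c^*(a))}{\pi}$. Moreover, if $a$ is not $\Psi^*$-almost everywhere zero and is continuous at $\Psi^*$-almost every point of $[0,\bar s]$, then the limit $c^*(a)$ exists and $$c^*(a)=\frac{\int s\,a(s)\,d\Psi^*(s)}{\sqrt{\int s^2\,d\Psi^*(s)\int a(s)^2\,d\Psi^*(s)}}.$$ -/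

import Mathlib

open MeasureTheory ProbabilityTheory Filter Topology

noncomputable section

namespace Apportion

variable {Ω : Type*} [MeasurableSpace Ω] {sbar abar : ℝ}

/-- The empirical distribution of the sizes of the groups `0, …, n` (the society with `n + 1`
groups), as a measure on `[0, sbar]`. -/
def sizeMeasure (s : ℕ → Set.Icc (0 : ℝ) sbar) (n : ℕ) : Measure (Set.Icc (0 : ℝ) sbar) :=
  ((n + 1 : ℕ) : ENNReal)⁻¹ • ∑ i ∈ Finset.range (n + 1), Measure.dirac (s i)

theorem isProbabilityMeasure_sizeMeasure (s : ℕ → Set.Icc (0 : ℝ) sbar) (n : ℕ) :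
    IsProbabilityMeasure (sizeMeasure s n) := by
  constructor
  simp only [sizeMeasure, Measure.smul_apply, Measure.finsetSum_apply, measure_univ,
    Finset.sum_const, Finset.card_range, smul_eq_mul, nsmul_eq_mul, mul_one]
  exact ENNReal.inv_mul_cancel (by simp) (ENNReal.natCast_ne_top _)

/-- The group-size distribution of the society with `n + 1` groups. -/
def sizeDist (s : ℕ → Set.Icc (0 : ℝ) sbar) (n : ℕ) :
    ProbabilityMeasure (Set.Icc (0 : ℝ) sbar) :=
  ⟨sizeMeasure s n, isProbabilityMeasure_sizeMeasure s n⟩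

/-- Total vote margin `S` in the society with `n` groups. -/
def voteMargin (s : ℕ → Set.Icc (0 : ℝ) sbar) (X : ℕ → Ω → ℝ) (n : ℕ) (ω : Ω) : ℝ :=
  ∑ i ∈ Finset.range n, (s i : ℝ) * X i ω

/-- Total weight margin `T` in the society with `n` groups. -/
def weightMargin (s : ℕ → Set.Icc (0 : ℝ) sbar)
    (a : Set.Icc (0 : ℝ) sbar → Set.Icc (0 : ℝ) abar)
    (r : ℝ → ℝ) (X : ℕ → Ω → ℝ) (n : ℕ) (ω : Ω) : ℝ :=
  ∑ i ∈ Finset.range n, (a (s i) : ℝ) * r (X i ω)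

open Classical in
/-- The social decision `D`: the sign of `T`, and the outcome of the coin `L n` in case of a
tie. -/
def decision (s : ℕ → Set.Icc (0 : ℝ) sbar)
    (a : Set.Icc (0 : ℝ) sbar → Set.Icc (0 : ℝ) abar)
    (r : ℝ → ℝ) (X L : ℕ → Ω → ℝ) (n : ℕ) (ω : Ω) : ℝ :=
  if weightMargin s a r X n ω = 0 then L n ω else Real.sign (weightMargin s a r X n ω)

/-- The standard deviation `σ` of `S`, that is `√(E[X₁²] ∑ sᵢ²)`. -/
def voteSD (P : Measure Ω) (s : ℕ → Set.Icc (0 : ℝ) sbar) (X : ℕ → Ω → ℝ) (n : ℕ) : ℝ :=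
  Real.sqrt ((∫ ω, X 0 ω ^ 2 ∂P) * ∑ i ∈ Finset.range n, (s i : ℝ) ^ 2)

/-- Normalized social welfare `W = D S / σ`. -/
def welfare (P : Measure Ω) (s : ℕ → Set.Icc (0 : ℝ) sbar)
    (a : Set.Icc (0 : ℝ) sbar → Set.Icc (0 : ℝ) abar)
    (r : ℝ → ℝ) (X L : ℕ → Ω → ℝ) (n : ℕ) (ω : Ω) : ℝ :=
  decision s a r X L n ω * voteMargin s X n ω / voteSD P s X n

/-- Expected welfare `u(a) = E[W]`. -/
def expectedWelfare (P : Measure Ω) (s : ℕ → Set.Icc (0 : ℝ) sbar)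
    (a : Set.Icc (0 : ℝ) sbar → Set.Icc (0 : ℝ) abar)
    (r : ℝ → ℝ) (X L : ℕ → Ω → ℝ) (n : ℕ) : ℝ :=
  ∫ ω, welfare P s a r X L n ω ∂P

/-- Normalized mean majority deficit `δ(a) = E[|S| / σ - W] / 2`. -/
def meanMajorityDeficit (P : Measure Ω) (s : ℕ → Set.Icc (0 : ℝ) sbar)
    (a : Set.Icc (0 : ℝ) sbar → Set.Icc (0 : ℝ) abar)
    (r : ℝ → ℝ) (X L : ℕ → Ω → ℝ) (n : ℕ) : ℝ :=
  (1 / 2) * ∫ ω, (|voteMargin s X n ω| / voteSD P s X n - welfare P s a r X L n ω) ∂P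

/-- Probability of inversion `p(a) = P{W < 0}`. -/
def inversionProbability (P : Measure Ω) (s : ℕ → Set.Icc (0 : ℝ) sbar)
    (a : Set.Icc (0 : ℝ) sbar → Set.Icc (0 : ℝ) abar)
    (r : ℝ → ℝ) (X L : ℕ → Ω → ℝ) (n : ℕ) : ℝ :=
  P.real {ω | welfare P s a r X L n ω < 0}

/-- Correlation coefficient `ρ` of the centred variables `X₁` and `r(X₁)` (zero when
`r(X₁) = 0` almost surely). -/
def corr (P : Measure Ω) (r : ℝ → ℝ) (X : ℕ → Ω → ℝ) : ℝ :=
  (∫ ω, X 0 ω * r (X 0 ω) ∂P) /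
    Real.sqrt ((∫ ω, X 0 ω ^ 2 ∂P) * ∫ ω, r (X 0 ω) ^ 2 ∂P)

/-- Cosine proportionality `c(a)` in the society with `n` groups. -/
def cosine (s : ℕ → Set.Icc (0 : ℝ) sbar)
    (a : Set.Icc (0 : ℝ) sbar → Set.Icc (0 : ℝ) abar) (n : ℕ) : ℝ :=
  (∑ i ∈ Finset.range n, (s i : ℝ) * (a (s i) : ℝ)) /
    Real.sqrt ((∑ i ∈ Finset.range n, (s i : ℝ) ^ 2) *
      ∑ i ∈ Finset.range n, (a (s i) : ℝ) ^ 2)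

/-- The integral formula for the asymptotic cosine proportionality under the limiting group-size
distribution `Ψ`. -/
def cosineIntegral (Ψ : ProbabilityMeasure (Set.Icc (0 : ℝ) sbar))
    (a : Set.Icc (0 : ℝ) sbar → Set.Icc (0 : ℝ) abar) : ℝ :=
  (∫ t, (t : ℝ) * (a t : ℝ) ∂(Ψ : Measure (Set.Icc (0 : ℝ) sbar))) /
    Real.sqrt ((∫ t, (t : ℝ) ^ 2 ∂(Ψ : Measure (Set.Icc (0 : ℝ) sbar))) *
      ∫ t, (a t : ℝ) ^ 2 ∂(Ψ : Measure (Set.Icc (0 : ℝ) sbar)))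

end Apportion

end

/-!
The argument rests on the pair `(U, V)` of the standardized vote margin `U = S / σ` and the
standardized weight margin `V = T / √(E[r(X₁)²] ∑ a(sᵢ)²)`, which has correlation exactly
`ρ c(a)` (`pairCorr`). Welfare is `D U`, where `D` is the sign of `V` outside ties.

If `∑ a(sᵢ)²` diverges and `r(X₁)` is not almost surely zero, all summands of `U` and `V` are
uniformly small, and the bivariate central limit theorem (`tendsto_stdPairLaw`, by characteristic
functions and Lévy's theorem) gives a normal limit with unit variances and correlation
`κ = ρ c*(a)`. The functions `u sign v` and `1_{u v < 0}` are continuous almost everywhere for the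
limit law, and the former has bounded second moments, so their expectations converge; ties have
vanishing probability. In the limit law `u = κ v + √(1 - κ²) w` with `w` independent of `v`, whence
`E[u sign v] = κ E|v| = κ √(2/π)`, and `P(u v < 0) = arccos κ / π` is Sheppard's formula
(`correlatedGaussian_re_mul_im_neg`), proved in polar coordinates. The allocation `a(s) = s` under
the rule `r(x) = x` has `κ = 1` and yields `E|U| → √(2/π)`, hence the mean majority deficit.

In the remaining cases `r(X₁) = 0` almost surely or `∑ a(sᵢ)² < ∞`, and then `ρ c*(a) = 0`, since a
square-summable weight sequence is asymptotically orthogonal to the sizes. Here `T` need not be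
asymptotically normal, but the decision is determined, up to small probability, by the coin and
finitely many groups (`exists_decision_approx_of_summable`). Reversing the margins of all later
groups preserves the joint law, so such a decision earns no expected welfare in the limit and
opposes the majority half of the time (`tendsto_of_finitely_determined`). If infinitely many weights
are nonzero this requires that near-ties among the first `k` groups be uniformly unlikely
(`exists_anticoncentration`): along a rapidly decreasing subsequence of the weights, each summand
reduces the concentration of the sum by a fixed factor.

The integral formula for `c*(a)` holds because averages over the groups of the bounded, almost
everywhere continuous functions `s²`, `a(s)²` and `s a(s)` converge to their integrals.
-/


namespace Apportion

/-! ### Characteristic functions of sums of small independent variables -/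

section

theorem norm_prod_sub_prod_le_sum {ι : Type*} (t : Finset ι) (f g : ι → ℂ)
    (hf : ∀ i ∈ t, ‖f i‖ ≤ 1) (hg : ∀ i ∈ t, ‖g i‖ ≤ 1) :
    ‖∏ i ∈ t, f i - ∏ i ∈ t, g i‖ ≤ ∑ i ∈ t, ‖f i - g i‖ := by
  classical
  induction t using Finset.induction_on with
  | empty => simp
  | insert j t hj ih =>
    rw [Finset.prod_insert hj, Finset.prod_insert hj, Finset.sum_insert hj]
    have h1 := ih (fun i hi => hf i (Finset.mem_insert_of_mem hi))
      (fun i hi => hg i (Finset.mem_insert_of_mem hi))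
    have h2 : ‖∏ i ∈ t, f i‖ ≤ 1 := by
      rw [norm_prod]
      exact Finset.prod_le_one (fun _ _ => norm_nonneg _)
        fun i hi => hf i (Finset.mem_insert_of_mem hi)
    have h3 := hg j (Finset.mem_insert_self j t)
    calc ‖f j * ∏ i ∈ t, f i - g j * ∏ i ∈ t, g i‖
        = ‖(f j - g j) * ∏ i ∈ t, f i + g j * (∏ i ∈ t, f i - ∏ i ∈ t, g i)‖ := by ring_nf
      _ ≤ ‖f j - g j‖ * ‖∏ i ∈ t, f i‖ + ‖g j‖ * ‖∏ i ∈ t, f i - ∏ i ∈ t, g i‖ := by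
        rw [← norm_mul, ← norm_mul]; exact norm_add_le _ _
      _ ≤ ‖f j - g j‖ * 1 + 1 * ∑ i ∈ t, ‖f i - g i‖ := by gcongr
      _ = _ := by ring

theorem norm_exp_mul_I_sub_quadratic_le {x : ℝ} (hx : |x| ≤ 1) :
    ‖Complex.exp (x * Complex.I) - (1 + x * Complex.I - (x : ℂ) ^ 2 / 2)‖ ≤ |x| ^ 3 := by
  have h := Complex.exp_bound (x := x * Complex.I) (by simpa using hx) (n := 3) (by norm_num)
  have e : ∑ m ∈ Finset.range 3, ((x : ℂ) * Complex.I) ^ m / (m.factorial : ℂ)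
      = 1 + x * Complex.I - (x : ℂ) ^ 2 / 2 := by
    simp [Finset.sum_range_succ, Nat.factorial, mul_pow]
    ring
  rw [e] at h
  refine h.trans ?_
  have : ‖(x : ℂ) * Complex.I‖ = |x| := by simp
  rw [this]
  norm_num [Nat.factorial]
  nlinarith [pow_nonneg (abs_nonneg x) 3]

variable {Ω : Type*} [MeasurableSpace Ω] {P : Measure Ω} [IsProbabilityMeasure P]

/-- Second-order expansion of the characteristic function (at `1`) of a small centred random
variable, compared with that of the centred normal law with the same variance. -/
theorem norm_charFun_one_sub_exp_le {Y : Ω → ℝ} (hY : Measurable Y) {ε : ℝ} (hε1 : ε ≤ 1)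
    (hb : ∀ ω, |Y ω| ≤ ε) (h0 : ∫ ω, Y ω ∂P = 0) :
    ‖charFun (P.map Y) 1 - Complex.exp ((-(∫ ω, Y ω ^ 2 ∂P) / 2 : ℝ))‖
      ≤ 2 * ε * ∫ ω, Y ω ^ 2 ∂P := by
  have hε : 0 ≤ ε := by
    obtain ⟨ω⟩ : Nonempty Ω := nonempty_of_isProbabilityMeasure P
    exact (abs_nonneg _).trans (hb ω)
  have hi1 : Integrable Y P := Integrable.of_bound hY.aestronglyMeasurable ε (ae_of_all _ hb)
  have hsq : ∀ ω, Y ω ^ 2 ≤ ε ^ 2 := fun ω => by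
    rw [← sq_abs]; exact pow_le_pow_left₀ (abs_nonneg _) (hb ω) 2
  have hi2 : Integrable (fun ω => Y ω ^ 2) P :=
    Integrable.of_bound (hY.pow_const 2).aestronglyMeasurable (ε ^ 2)
      (ae_of_all _ fun ω => by rw [Real.norm_eq_abs, abs_of_nonneg (sq_nonneg _)]; exact hsq ω)
  set v := ∫ ω, Y ω ^ 2 ∂P with hv
  have hv0 : 0 ≤ v := integral_nonneg fun _ => sq_nonneg _
  have hvε : v ≤ ε ^ 2 := by
    have := integral_mono hi2 (integrable_const (ε ^ 2)) hsq
    simpa using this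
  have hm : Measurable fun ω => Complex.exp (Y ω * Complex.I) := by fun_prop
  have hie : Integrable (fun ω => Complex.exp (Y ω * Complex.I)) P :=
    Integrable.of_bound hm.aestronglyMeasurable 1
      (ae_of_all _ fun ω => (Complex.norm_exp_ofReal_mul_I _).le)
  have e1 : charFun (P.map Y) 1 = ∫ ω, Complex.exp (Y ω * Complex.I) ∂P := by
    rw [charFun_apply_real, integral_map hY.aemeasurable (by fun_prop)]
    simp
  have hq : Integrable (fun ω => (1 + (Y ω : ℂ) * Complex.I - (Y ω : ℂ) ^ 2 / 2)) P := by
    refine ((integrable_const _).add (hi1.ofReal.mul_const _)).sub ?_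
    have := (hi2.ofReal (𝕜 := ℂ)).div_const 2
    simpa using this
  have e2 : ∫ ω, (1 + (Y ω : ℂ) * Complex.I - (Y ω : ℂ) ^ 2 / 2) ∂P = ((1 - v / 2 : ℝ) : ℂ) := by
    have hi2' : Integrable (fun ω => (Y ω : ℂ) ^ 2 / 2) P := by
      have := (hi2.ofReal (𝕜 := ℂ)).div_const 2
      simpa using this
    have hi1' : Integrable (fun ω => (Y ω : ℂ) * Complex.I) P := hi1.ofReal.mul_const _
    have hi1'' : Integrable (fun ω => 1 + (Y ω : ℂ) * Complex.I) P := (integrable_const _).add hi1'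
    rw [integral_sub hi1'' hi2', integral_add (integrable_const _) hi1',
      integral_mul_const, integral_div]
    have a1 : ∫ ω, (Y ω : ℂ) ∂P = 0 := by rw [integral_complex_ofReal, h0]; simp
    have a2 : ∫ ω, (Y ω : ℂ) ^ 2 ∂P = (v : ℂ) := by
      rw [hv, ← integral_complex_ofReal]; simp
    rw [a1, a2]; simp
  have k1 : ‖charFun (P.map Y) 1 - ((1 - v / 2 : ℝ) : ℂ)‖ ≤ ε * v := by
    rw [e1, ← e2, ← integral_sub hie hq]
    refine (norm_integral_le_of_norm_le (g := fun ω => ε * Y ω ^ 2) (hi2.const_mul ε)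
      (ae_of_all _ fun ω => ?_)).trans ?_
    · refine (norm_exp_mul_I_sub_quadratic_le ((hb ω).trans hε1)).trans ?_
      rw [← sq_abs (Y ω)]
      nlinarith [hb ω, sq_nonneg |Y ω|, abs_nonneg (Y ω)]
    · rw [integral_const_mul]
  have k2 : ‖((1 - v / 2 : ℝ) : ℂ) - Complex.exp ((-v / 2 : ℝ))‖ ≤ ε * v := by
    rw [← Complex.ofReal_exp, ← Complex.ofReal_sub, Complex.norm_real, Real.norm_eq_abs, abs_sub_comm]
    have hv1 : v ≤ 1 := by nlinarith
    have := Real.abs_exp_sub_one_sub_id_le (x := -v / 2) (by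
      rw [abs_le]; constructor <;> linarith)
    have e : Real.exp (-v / 2) - (1 - v / 2) = Real.exp (-v / 2) - 1 - -v / 2 := by ring
    rw [e]
    refine this.trans ?_
    nlinarith
  calc _ = ‖(charFun (P.map Y) 1 - ((1 - v / 2 : ℝ) : ℂ))
        + (((1 - v / 2 : ℝ) : ℂ) - Complex.exp ((-v / 2 : ℝ)))‖ := by ring_nf
    _ ≤ ε * v + ε * v := (norm_add_le _ _).trans (add_le_add k1 k2)
    _ = _ := by ring

/-- Quantitative central limit theorem, at the level of characteristic functions, for a finite sum
of independent, centred, uniformly small random variables. -/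
theorem norm_charFun_sum_sub_exp_le {n : ℕ} {Y : ℕ → Ω → ℝ} (hY : ∀ i, Measurable (Y i))
    (hind : iIndepFun Y P) {ε : ℝ} (hε1 : ε ≤ 1) (hb : ∀ i ∈ Finset.range n, ∀ ω, |Y i ω| ≤ ε)
    (h0 : ∀ i, ∫ ω, Y i ω ∂P = 0) :
    ‖charFun (P.map (fun ω => ∑ i ∈ Finset.range n, Y i ω)) 1
        - Complex.exp ((-(∑ i ∈ Finset.range n, ∫ ω, Y i ω ^ 2 ∂P) / 2 : ℝ))‖
      ≤ 2 * ε * ∑ i ∈ Finset.range n, ∫ ω, Y i ω ^ 2 ∂P := by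
  have hprob : ∀ i, IsProbabilityMeasure (P.map (Y i)) := fun i =>
    Measure.isProbabilityMeasure_map (hY i).aemeasurable
  rw [iIndepFun.charFun_map_fun_finsetSum_eq_prod (fun i _ => (hY i).aemeasurable)
    (hind.restrict _), Finset.prod_apply]
  have e : Complex.exp ((-(∑ i ∈ Finset.range n, ∫ ω, Y i ω ^ 2 ∂P) / 2 : ℝ))
      = ∏ i ∈ Finset.range n, Complex.exp ((-(∫ ω, Y i ω ^ 2 ∂P) / 2 : ℝ)) := by
    rw [← Complex.exp_sum, ← Complex.ofReal_sum, ← Finset.sum_div, Finset.sum_neg_distrib]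
  rw [e, Finset.mul_sum]
  refine (norm_prod_sub_prod_le_sum _ _ _ (fun i _ => norm_charFun_le_one _) fun i _ => ?_).trans
    (Finset.sum_le_sum fun i hi => norm_charFun_one_sub_exp_le (hY i) hε1 (hb i hi) (h0 i))
  rw [← Complex.ofReal_exp, Complex.norm_real, Real.norm_eq_abs, Real.abs_exp, Real.exp_le_one_iff]
  have : 0 ≤ ∫ ω, Y i ω ^ 2 ∂P := integral_nonneg fun _ => sq_nonneg _
  linarith

end

/-! ### Weak convergence and functions that are almost everywhere continuous -/

section

/-- The mapping theorem: weak convergence is preserved by maps that are continuous at almost every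
point for the limit law. -/
theorem tendsto_map_of_ae_continuousAt {E F : Type*} [MeasurableSpace E] [TopologicalSpace E]
    [OpensMeasurableSpace E] [HasOuterApproxClosed E] [MeasurableSpace F] [TopologicalSpace F]
    [OpensMeasurableSpace F] [HasOuterApproxClosed F]
    {μs : ℕ → ProbabilityMeasure E} {μ : ProbabilityMeasure E}
    (h : Tendsto μs atTop (𝓝 μ)) {f : E → F} (hf : Measurable f)
    (hc : ∀ᵐ x ∂(μ : Measure E), ContinuousAt f x) :
    Tendsto (fun n => (μs n).map hf.aemeasurable) atTop (𝓝 (μ.map hf.aemeasurable)) := by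
  refine tendsto_of_forall_isClosed_limsup_le' fun C hC => ?_
  have e : ∀ ν : ProbabilityMeasure E, ((ν.map hf.aemeasurable : ProbabilityMeasure F) : Measure F) C
      = (ν : Measure E) (f ⁻¹' C) := fun ν => by
    rw [ProbabilityMeasure.toMeasure_map, Measure.map_apply hf hC.measurableSet]
  simp only [e]
  calc limsup (fun n => (μs n : Measure E) (f ⁻¹' C)) atTop
      ≤ limsup (fun n => (μs n : Measure E) (closure (f ⁻¹' C))) atTop :=
        limsup_le_limsup (Eventually.of_forall fun n => measure_mono subset_closure)
    _ ≤ (μ : Measure E) (closure (f ⁻¹' C)) :=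
        ProbabilityMeasure.limsup_measure_closed_le_of_tendsto h isClosed_closure
    _ ≤ (μ : Measure E) (f ⁻¹' C) := by
        refine measure_mono_ae ?_
        filter_upwards [hc] with x hx hxc
        have : f x ∈ closure (f '' (f ⁻¹' C)) := mem_closure_image hx hxc
        exact closure_minimal (Set.image_preimage_subset f C) hC this

/-- Truncation error, controlled by the second moment. -/
theorem abs_integral_sub_integral_clamp_le {ν : Measure ℝ} [IsProbabilityMeasure ν] {C M : ℝ}
    (hM : 0 < M) (hi : Integrable (fun x => x ^ 2) ν) (hC : ∫ x, x ^ 2 ∂ν ≤ C) :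
    |∫ x, x ∂ν - ∫ x, max (-M) (min M x) ∂ν| ≤ C / M := by
  have h1 : Integrable (fun x : ℝ => x) ν := by
    have : MemLp (fun x : ℝ => x) 2 ν :=
      (memLp_two_iff_integrable_sq (by fun_prop)).2 hi
    exact this.integrable (by norm_num)
  have h2 : Integrable (fun x : ℝ => max (-M) (min M x)) ν := by
    refine Integrable.of_bound (by fun_prop) M (ae_of_all _ fun x => ?_)
    rw [Real.norm_eq_abs, abs_le]
    exact ⟨le_max_left _ _, max_le (by linarith) (min_le_left _ _)⟩
  rw [← integral_sub h1 h2, ← Real.norm_eq_abs]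
  refine (norm_integral_le_of_norm_le (g := fun x => x ^ 2 / M) (hi.div_const M)
    (ae_of_all _ fun x => ?_)).trans ?_
  · rw [Real.norm_eq_abs, le_div_iff₀ hM]
    rcases le_total M x with h | h
    · rw [min_eq_left h, max_eq_right (by linarith), abs_of_nonneg (by linarith)]
      nlinarith
    · rw [min_eq_right h]
      rcases le_total (-M) x with h' | h'
      · rw [max_eq_right h']; simp; positivity
      · rw [max_eq_left h', abs_of_nonpos (by linarith)]
        nlinarith
  · rw [integral_div]; gcongr

/-- Along weakly convergent laws, the expectation of an almost everywhere continuous function with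
bounded second moments converges. -/
theorem tendsto_integral_of_ae_continuousAt {E : Type*} [MeasurableSpace E] [TopologicalSpace E]
    [OpensMeasurableSpace E] [HasOuterApproxClosed E]
    {μs : ℕ → ProbabilityMeasure E} {μ : ProbabilityMeasure E}
    (h : Tendsto μs atTop (𝓝 μ)) {f : E → ℝ} (hf : Measurable f)
    (hc : ∀ᵐ x ∂(μ : Measure E), ContinuousAt f x) {C : ℝ}
    (hi : Integrable (fun x => f x ^ 2) (μ : Measure E)) (hC : ∫ x, f x ^ 2 ∂(μ : Measure E) ≤ C)
    (his : ∀ᶠ n in atTop, Integrable (fun x => f x ^ 2) (μs n : Measure E))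
    (hCs : ∀ᶠ n in atTop, ∫ x, f x ^ 2 ∂(μs n : Measure E) ≤ C) :
    Tendsto (fun n => ∫ x, f x ∂(μs n : Measure E)) atTop (𝓝 (∫ x, f x ∂(μ : Measure E))) := by
  have hm := tendsto_map_of_ae_continuousAt h hf hc
  have key : ∀ (ν : ProbabilityMeasure E), Integrable (fun x => f x ^ 2) (ν : Measure E) →
      ∫ x, f x ^ 2 ∂(ν : Measure E) ≤ C → ∀ M : ℝ, 0 < M →
      |∫ x, f x ∂(ν : Measure E) - ∫ x, max (-M) (min M x) ∂((ν.map hf.aemeasurable :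
        ProbabilityMeasure ℝ) : Measure ℝ)| ≤ C / M := by
    intro ν h1 h2 M hM
    rw [ProbabilityMeasure.toMeasure_map]
    have := Measure.isProbabilityMeasure_map (μ := (ν : Measure E)) hf.aemeasurable
    have := abs_integral_sub_integral_clamp_le (ν := (ν : Measure E).map f) (C := C) hM
      ((integrable_map_measure (by fun_prop) hf.aemeasurable).2 h1)
      (by rwa [integral_map hf.aemeasurable (by fun_prop)])
    rwa [integral_map hf.aemeasurable (f := fun x => x) (by fun_prop)] at this
  have hC0 : 0 ≤ C := (integral_nonneg fun _ => sq_nonneg _).trans hC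
  rw [Metric.tendsto_atTop']
  rw [ProbabilityMeasure.tendsto_iff_forall_integral_tendsto] at hm
  intro ε hε
  obtain ⟨M, hM0, hM⟩ : ∃ M : ℝ, 0 < M ∧ C / M < ε / 3 := by
    refine ⟨3 * C / ε + 1, by positivity, ?_⟩
    rw [div_lt_iff₀ (by positivity)]
    field_simp
    nlinarith
  let g : BoundedContinuousFunction ℝ ℝ :=
    BoundedContinuousFunction.ofNormedAddCommGroup (fun x => max (-M) (min M x)) (by fun_prop) M
      (fun x => by
        rw [Real.norm_eq_abs, abs_le]
        exact ⟨le_max_left _ _, max_le (by linarith) (min_le_left _ _)⟩)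
  have hg := Metric.tendsto_nhds.1 (hm g) (ε / 3) (by positivity)
  obtain ⟨N, hN⟩ := eventually_atTop.1 (hg.and (his.and hCs))
  refine ⟨N, fun n hn => ?_⟩
  obtain ⟨h1, h2, h3⟩ := hN n hn.le
  have k1 := key (μs n) h2 h3 M hM0
  have k2 := key μ hi hC M hM0
  rw [Real.dist_eq] at h1 ⊢
  change |∫ x, max (-M) (min M x) ∂_ - ∫ x, max (-M) (min M x) ∂_| < ε / 3 at h1
  rw [abs_le] at k1 k2
  rw [abs_lt] at h1 ⊢
  constructor <;> linarith

end

/-! ### The bivariate normal law and Sheppard's formula -/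

section

/-- The standard normal law on the plane. -/
noncomputable def stdGaussianPlane : Measure (ℝ × ℝ) :=
  (gaussianReal 0 1).prod (gaussianReal 0 1)

instance : IsProbabilityMeasure stdGaussianPlane := by
  unfold stdGaussianPlane; infer_instance

/-- The point with imaginary part `z₁` and real part `κ z₁ + √(1 - κ²) z₂`: for independent standard
normal `z₁` and `z₂` both parts are standard normal, with correlation `κ`. -/
noncomputable def correlatedPair (κ : ℝ) (p : ℝ × ℝ) : ℂ :=
  ⟨κ * p.1 + √(1 - κ ^ 2) * p.2, p.1⟩

theorem measurable_correlatedPair (κ : ℝ) : Measurable (correlatedPair κ) := by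
  have : correlatedPair κ = fun p => ((κ * p.1 + √(1 - κ ^ 2) * p.2 : ℝ) : ℂ)
      + (p.1 : ℝ) * Complex.I := by
    funext p
    apply Complex.ext <;> simp [correlatedPair]
  rw [this]
  fun_prop

/-- The centred normal law on `ℂ ≃ ℝ²` with unit variances and correlation `κ`. The complex plane
is used as it is the two-dimensional inner product space whose coordinates are readily at hand. -/
noncomputable def correlatedGaussian (κ : ℝ) : ProbabilityMeasure ℂ :=
  ⟨stdGaussianPlane.map (correlatedPair κ),
    Measure.isProbabilityMeasure_map (measurable_correlatedPair κ).aemeasurable⟩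

theorem coe_correlatedGaussian (κ : ℝ) : (correlatedGaussian κ : Measure ℂ)
    = stdGaussianPlane.map (correlatedPair κ) := rfl

theorem charFun_correlatedGaussian {κ : ℝ} (hκ : |κ| ≤ 1) (t : ℂ) :
    charFun (correlatedGaussian κ : Measure ℂ) t
      = Complex.exp ((-(t.re ^ 2 + 2 * κ * t.re * t.im + t.im ^ 2) / 2 : ℝ)) := by
  have hs : √(1 - κ ^ 2) ^ 2 = 1 - κ ^ 2 := Real.sq_sqrt (by
    have := abs_le.1 hκ; nlinarith)
  rw [coe_correlatedGaussian, charFun_apply,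
    integral_map (measurable_correlatedPair κ).aemeasurable (by fun_prop)]
  have e : ∀ p : ℝ × ℝ, Complex.exp ((inner ℝ (correlatedPair κ p) t : ℝ) * Complex.I)
      = Complex.exp (((κ * t.re + t.im : ℝ) : ℂ) * p.1 * Complex.I)
        * Complex.exp (((√(1 - κ ^ 2) * t.re : ℝ) : ℂ) * p.2 * Complex.I) := by
    intro p
    rw [← Complex.exp_add]
    congr 1
    rw [Complex.inner]
    simp only [correlatedPair, Complex.mul_re, Complex.conj_re, Complex.conj_im]
    push_cast
    ring
  simp_rw [e]
  rw [stdGaussianPlane, integral_prod_mul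
    (fun x : ℝ => Complex.exp (((κ * t.re + t.im : ℝ) : ℂ) * x * Complex.I))
    (fun y : ℝ => Complex.exp (((√(1 - κ ^ 2) * t.re : ℝ) : ℂ) * y * Complex.I)),
    ← charFun_apply_real, ← charFun_apply_real, charFun_gaussianReal, charFun_gaussianReal,
    ← Complex.exp_add]
  congr 1
  have hs' : (√(1 - κ ^ 2) : ℂ) ^ 2 = 1 - (κ : ℂ) ^ 2 := by exact_mod_cast hs
  push_cast
  linear_combination (-(t.re : ℂ) ^ 2 / 2) * hs'

theorem ae_gaussian_ne_zero : ∀ᵐ x ∂(gaussianReal 0 1), x ≠ 0 := by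
  have := nullSingletonClass_gaussianReal (μ := 0) (v := 1) one_ne_zero
  rw [ae_iff]
  simp

theorem ae_correlatedGaussian_im_ne_zero (κ : ℝ) :
    ∀ᵐ z ∂(correlatedGaussian κ : Measure ℂ), z.im ≠ 0 := by
  rw [coe_correlatedGaussian, ae_map_iff (measurable_correlatedPair κ).aemeasurable
    (by measurability)]
  simp only [correlatedPair]
  exact (Measure.quasiMeasurePreserving_fst (μ := gaussianReal 0 1) (ν := gaussianReal 0 1)).ae
    ae_gaussian_ne_zero

theorem integral_abs_gaussian : ∫ x, |x| ∂(gaussianReal 0 1) = √(2 / Real.pi) := by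
  rw [integral_gaussianReal_eq_integral_smul one_ne_zero]
  have h := integral_comp_abs (f := fun x => gaussianPDFReal 0 1 x * x)
  have e1 : ∀ x : ℝ, gaussianPDFReal 0 1 |x| * |x| = gaussianPDFReal 0 1 x • |x| := fun x => by
    simp [gaussianPDFReal]
  simp_rw [e1] at h
  rw [h]
  have e2 : ∀ x : ℝ, gaussianPDFReal 0 1 x * x
      = (√(2 * Real.pi))⁻¹ * (x ^ (1 : ℝ) * Real.exp (-(1 / 2) * x ^ (2 : ℝ))) := fun x => by
    simp [gaussianPDFReal]
    ring_nf
  simp_rw [e2]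
  rw [integral_const_mul, integral_rpow_mul_exp_neg_mul_rpow (by norm_num) (by norm_num)
    (by norm_num)]
  norm_num
  have : √2 * √2 = 2 := Real.mul_self_sqrt (by norm_num)
  field_simp
  linarith

theorem memLp_id_gaussian : MemLp (fun x : ℝ => x) 2 (gaussianReal 0 1) :=
  memLp_id_gaussianReal 2

theorem memLp_correlatedGaussian_re (κ : ℝ) :
    MemLp (fun z : ℂ => z.re) 2 (correlatedGaussian κ : Measure ℂ) := by
  rw [coe_correlatedGaussian, memLp_map_measure_iff (by fun_prop)
    (measurable_correlatedPair κ).aemeasurable]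
  have h1 : MemLp (fun p : ℝ × ℝ => p.1) 2 stdGaussianPlane :=
    memLp_id_gaussian.comp_measurePreserving measurePreserving_fst
  have h2 : MemLp (fun p : ℝ × ℝ => p.2) 2 stdGaussianPlane :=
    memLp_id_gaussian.comp_measurePreserving measurePreserving_snd
  exact (h1.const_mul κ).add (h2.const_mul _)

theorem measurable_sign : Measurable Real.sign := by
  have : Real.sign = fun r : ℝ => if r < 0 then -1 else if 0 < r then 1 else 0 := by
    funext r; simp [Real.sign]
  rw [this]
  exact Measurable.ite measurableSet_Iio measurable_const
    (Measurable.ite measurableSet_Ioi measurable_const measurable_const)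

theorem abs_sign_le_one (x : ℝ) : |Real.sign x| ≤ 1 := by
  rcases Real.sign_apply_eq x with h | h | h <;> simp [h]

theorem mul_sign_self (x : ℝ) : x * Real.sign x = |x| := by
  rcases lt_trichotomy x 0 with h | h | h
  · rw [Real.sign_of_neg h, abs_of_neg h]; ring
  · simp [h]
  · rw [Real.sign_of_pos h, abs_of_pos h]; ring

/-- As the imaginary part is `z₁` and the real part `κ z₁ + √(1 - κ²) z₂`, the expectation is that of
`κ |z₁|`. -/
theorem integral_re_mul_sign_im (κ : ℝ) :
    ∫ z, z.re * Real.sign z.im ∂(correlatedGaussian κ : Measure ℂ) = √(2 / Real.pi) * κ := by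
  have hs := measurable_sign
  rw [coe_correlatedGaussian, integral_map (measurable_correlatedPair κ).aemeasurable
    (by fun_prop)]
  simp only [correlatedPair, add_mul, mul_assoc, mul_sign_self]
  have hi := (memLp_id_gaussian.integrable (by norm_num))
  have i1 : Integrable (fun p : ℝ × ℝ => κ * |p.1|) stdGaussianPlane :=
    ((hi.abs).comp_fst _).const_mul κ
  have hsg : Integrable Real.sign (gaussianReal 0 1) :=
    Integrable.of_bound hs.aestronglyMeasurable 1 (ae_of_all _ abs_sign_le_one)
  have i2 : Integrable (fun p : ℝ × ℝ => √(1 - κ ^ 2) * (p.2 * Real.sign p.1)) stdGaussianPlane := by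
    refine Integrable.const_mul ?_ _
    simp_rw [mul_comm _ (Real.sign _)]
    exact hsg.mul_prod hi
  rw [integral_add i1 i2, integral_const_mul, integral_const_mul]
  simp_rw [mul_comm _ (Real.sign _)]
  rw [stdGaussianPlane, integral_fun_fst (fun x : ℝ => |x|), integral_prod_mul Real.sign (fun y => y),
    integral_abs_gaussian, integral_id_gaussianReal]
  simp [mul_comm]

theorem measurePreserving_neg_stdGaussianPlane :
    MeasurePreserving (fun p : ℝ × ℝ => (-p.1, -p.2)) stdGaussianPlane stdGaussianPlane := by
  have h : MeasurePreserving (fun x : ℝ => -x) (gaussianReal 0 1) (gaussianReal 0 1) :=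
    ⟨by fun_prop, by rw [gaussianReal_map_neg]; simp⟩
  exact h.prod h

theorem cos_pos_and_cos_sub_neg_iff {α θ : ℝ} (h0 : 0 ≤ α) (h1 : α ≤ Real.pi)
    (hθ : θ ∈ Set.Ioo (-Real.pi) Real.pi) :
    (0 < Real.cos θ ∧ Real.cos (θ - α) < 0) ↔
      θ ∈ Set.Ioo (-(Real.pi / 2)) (α - Real.pi / 2) := by
  have hπ := Real.pi_pos
  constructor
  · rintro ⟨hc, hn⟩
    have a1 : -(Real.pi / 2) < θ := by
      by_contra! h
      have : Real.cos (θ + Real.pi) ≥ 0 :=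
        Real.cos_nonneg_of_mem_Icc ⟨by linarith [hθ.1], by linarith⟩
      rw [Real.cos_add_pi] at this; linarith
    have a2 : θ < Real.pi / 2 := by
      by_contra! h
      have : Real.cos (θ - Real.pi) ≥ 0 :=
        Real.cos_nonneg_of_mem_Icc ⟨by linarith, by linarith [hθ.2]⟩
      rw [Real.cos_sub_pi] at this; linarith
    refine ⟨a1, ?_⟩
    by_contra! h
    have : Real.cos (θ - α) ≥ 0 := Real.cos_nonneg_of_mem_Icc ⟨by linarith, by linarith⟩
    linarith
  · rintro ⟨a1, a2⟩
    refine ⟨Real.cos_pos_of_mem_Ioo ⟨a1, by linarith⟩, ?_⟩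
    have : 0 < Real.cos (θ - α + Real.pi) :=
      Real.cos_pos_of_mem_Ioo ⟨by linarith, by linarith⟩
    rw [Real.cos_add_pi] at this; linarith

theorem stdGaussianPlane_eq_withDensity : stdGaussianPlane = (volume : Measure (ℝ × ℝ)).withDensity
    (fun p => ENNReal.ofReal ((2 * Real.pi)⁻¹ * Real.exp (-(p.1 ^ 2 + p.2 ^ 2) / 2))) := by
  rw [stdGaussianPlane, gaussianReal_of_var_ne_zero _ one_ne_zero,
    prod_withDensity (measurable_gaussianPDF 0 1) (measurable_gaussianPDF 0 1)]
  rw [Measure.volume_eq_prod]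
  congr 1
  funext p
  rw [gaussianPDF, gaussianPDF, ← ENNReal.ofReal_mul (gaussianPDFReal_nonneg _ _ _)]
  congr 1
  simp only [gaussianPDFReal, NNReal.coe_one, mul_one, sub_zero]
  rw [mul_mul_mul_comm, ← Real.exp_add, ← mul_inv, Real.mul_self_sqrt (by positivity)]
  ring_nf

theorem lintegral_radial_gaussian :
    ∫⁻ r in Set.Ioi (0 : ℝ), ENNReal.ofReal (r * ((2 * Real.pi)⁻¹ * Real.exp (-r ^ 2 / 2)))
      = ENNReal.ofReal (2 * Real.pi)⁻¹ := by
  have h := integral_rpow_mul_exp_neg_mul_rpow (p := 2) (q := 1) (b := 1 / 2)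
    (by norm_num) (by norm_num) (by norm_num)
  have hi := integrableOn_rpow_mul_exp_neg_mul_rpow (p := 2) (s := 1) (b := 1 / 2)
    (by norm_num) (by norm_num) (by norm_num)
  have e : ∀ r : ℝ, r * ((2 * Real.pi)⁻¹ * Real.exp (-r ^ 2 / 2))
      = (2 * Real.pi)⁻¹ * (r ^ (1 : ℝ) * Real.exp (-(1 / 2) * r ^ (2 : ℝ))) := fun r => by
    simp; ring_nf
  simp_rw [e]
  rw [← ofReal_integral_eq_lintegral_ofReal (hi.const_mul _), integral_const_mul, h]
  · norm_num
  · refine (ae_restrict_iff' measurableSet_Ioi).2 (ae_of_all _ fun r hr => ?_)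
    have : (0:ℝ) < r := hr
    simp only [Pi.zero_apply]
    positivity

/-- By rotational symmetry, the sector between the half-plane `0 < x` and the half-plane where
`x cos α + y sin α < 0`, which has opening angle `α`, carries the fraction `α / 2π` of the mass. -/
theorem stdGaussianPlane_sector {α : ℝ} (h0 : 0 ≤ α) (h1 : α ≤ Real.pi) :
    stdGaussianPlane {p | 0 < p.1 ∧ Real.cos α * p.1 + Real.sin α * p.2 < 0}
      = ENNReal.ofReal (α / (2 * Real.pi)) := by
  have hπ := Real.pi_pos
  have hm : MeasurableSet {p : ℝ × ℝ | 0 < p.1 ∧ Real.cos α * p.1 + Real.sin α * p.2 < 0} :=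
    (measurableSet_lt measurable_const measurable_fst).inter
      (measurableSet_lt ((measurable_fst.const_mul _).add (measurable_snd.const_mul _)) measurable_const)
  rw [stdGaussianPlane_eq_withDensity, withDensity_apply _ hm, ← lintegral_indicator hm,
    ← lintegral_comp_polarCoord_symm]
  have e : ∀ p ∈ polarCoord.target, ENNReal.ofReal p.1 •
      ({p : ℝ × ℝ | 0 < p.1 ∧ Real.cos α * p.1 + Real.sin α * p.2 < 0}.indicator
        (fun p => ENNReal.ofReal ((2 * Real.pi)⁻¹ * Real.exp (-(p.1 ^ 2 + p.2 ^ 2) / 2))))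
        (polarCoord.symm p)
      = ENNReal.ofReal (p.1 * ((2 * Real.pi)⁻¹ * Real.exp (-p.1 ^ 2 / 2))) *
        (Set.Ioo (-(Real.pi / 2)) (α - Real.pi / 2)).indicator (fun _ => 1) p.2 := by
    rintro ⟨r, θ⟩ ⟨hr, hθ⟩
    have hr : 0 < r := hr
    have hiff : ((polarCoord.symm (r, θ)) ∈
        {p : ℝ × ℝ | 0 < p.1 ∧ Real.cos α * p.1 + Real.sin α * p.2 < 0}) ↔
        θ ∈ Set.Ioo (-(Real.pi / 2)) (α - Real.pi / 2) := by
      rw [← cos_pos_and_cos_sub_neg_iff h0 h1 hθ]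
      simp only [polarCoord_symm_apply, Set.mem_ofPred_eq]
      refine and_congr (by rw [mul_pos_iff_of_pos_left hr]) ?_
      rw [show Real.cos α * (r * Real.cos θ) + Real.sin α * (r * Real.sin θ)
        = r * Real.cos (θ - α) by rw [Real.cos_sub]; ring]
      exact ⟨fun h => by by_contra! h'; linarith [mul_nonneg hr.le h'], fun h => mul_neg_of_pos_of_neg hr h⟩
    by_cases hin : θ ∈ Set.Ioo (-(Real.pi / 2)) (α - Real.pi / 2)
    · rw [Set.indicator_of_mem (hiff.2 hin), Set.indicator_of_mem hin, smul_eq_mul, mul_one,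
        ← ENNReal.ofReal_mul hr.le]
      simp only [polarCoord_symm_apply]
      rw [mul_pow, mul_pow, ← mul_add, Real.cos_sq_add_sin_sq, mul_one]
    · rw [Set.indicator_of_notMem (fun h => hin (hiff.1 h)), Set.indicator_of_notMem hin]
      simp
  rw [setLIntegral_congr_fun polarCoord.open_target.measurableSet e, polarCoord_target,
    Measure.volume_eq_prod, ← Measure.prod_restrict,
    lintegral_prod_mul (f := fun r => ENNReal.ofReal (r * ((2 * Real.pi)⁻¹ * Real.exp (-r ^ 2 / 2))))
      (by fun_prop) (by
        exact (measurable_const.indicator measurableSet_Ioo).aemeasurable),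
    lintegral_radial_gaussian, lintegral_indicator measurableSet_Ioo,
    Measure.restrict_restrict measurableSet_Ioo]
  have hsub : Set.Ioo (-(Real.pi / 2)) (α - Real.pi / 2) ∩ Set.Ioo (-Real.pi) Real.pi
      = Set.Ioo (-(Real.pi / 2)) (α - Real.pi / 2) :=
    Set.inter_eq_left.2 (Set.Ioo_subset_Ioo (by linarith) (by linarith))
  rw [hsub]
  simp only [lintegral_one, Measure.restrict_apply_univ, Real.volume_Ioo]
  rw [← ENNReal.ofReal_mul (by positivity)]
  congr 1
  field_simp
  ring

/-- **Sheppard's formula**: the probability that two standard normal variables with correlation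
`κ` have opposite signs. -/
theorem correlatedGaussian_re_mul_im_neg {κ : ℝ} (hκ : |κ| ≤ 1) :
    (correlatedGaussian κ : Measure ℂ).real {z | z.re * z.im < 0} = Real.arccos κ / Real.pi := by
  have hκ' := abs_le.1 hκ
  have hπ := Real.pi_pos
  set A := {p : ℝ × ℝ | 0 < p.1 ∧ κ * p.1 + √(1 - κ ^ 2) * p.2 < 0} with hA
  have hAm : MeasurableSet A :=
    (measurableSet_lt measurable_const measurable_fst).inter
      (measurableSet_lt ((measurable_fst.const_mul _).add (measurable_snd.const_mul _)) measurable_const)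
  have hAv : stdGaussianPlane A = ENNReal.ofReal (Real.arccos κ / (2 * Real.pi)) := by
    have := stdGaussianPlane_sector (Real.arccos_nonneg κ) (Real.arccos_le_pi κ)
    rwa [Real.cos_arccos hκ'.1 hκ'.2, Real.sin_arccos] at this
  set B := (fun p : ℝ × ℝ => (-p.1, -p.2)) ⁻¹' A with hB
  have hBv : stdGaussianPlane B = ENNReal.ofReal (Real.arccos κ / (2 * Real.pi)) := by
    rw [hB, measurePreserving_neg_stdGaussianPlane.measure_preimage hAm.nullMeasurableSet, hAv]
  have hBm : MeasurableSet B := measurePreserving_neg_stdGaussianPlane.measurable hAm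
  have hdis : Disjoint A B := by
    rw [Set.disjoint_left]
    rintro p ⟨h1, -⟩ ⟨h2, -⟩
    simp only at h2
    linarith
  -- opposite signs: the sector `A` and its reflection `B` in the origin
  have hun : correlatedPair κ ⁻¹' {z | z.re * z.im < 0} = A ∪ B := by
    ext p
    simp only [correlatedPair, Set.mem_preimage, Set.mem_ofPred_eq, Set.mem_union, hA, hB,
      mul_neg_iff]
    constructor
    · rintro (⟨h1, h2⟩ | ⟨h1, h2⟩)
      · right; constructor <;> linarith
      · left; exact ⟨h2, h1⟩
    · rintro (⟨h1, h2⟩ | ⟨h1, h2⟩)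
      · right; exact ⟨h2, h1⟩
      · left; constructor <;> linarith
  have hzm : MeasurableSet {z : ℂ | z.re * z.im < 0} :=
    measurableSet_lt (by fun_prop) measurable_const
  rw [coe_correlatedGaussian, measureReal_def, Measure.map_apply (measurable_correlatedPair κ) hzm,
    hun, measure_union hdis hBm, hAv, hBv, ← ENNReal.ofReal_add, ENNReal.toReal_ofReal]
  · field_simp; norm_num
  all_goals have := Real.arccos_nonneg κ; positivity

end

/-! ### The bivariate central limit theorem for weighted sums -/

section

variable {Ω : Type*} [MeasurableSpace Ω] {P : Measure Ω} [IsProbabilityMeasure P]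

/-- Independent identically distributed symmetric vote margins with values in `[-1, 1]`. -/
structure IsMarginSeq (P : Measure Ω) (X : ℕ → Ω → ℝ) : Prop where
  meas : ∀ i, Measurable (X i)
  mem_Icc : ∀ i ω, X i ω ∈ Set.Icc (-1 : ℝ) 1
  indep : iIndepFun X P
  ident : ∀ i, IdentDistrib (X i) (X 0) P P
  symm : IdentDistrib (fun ω => -X 0 ω) (X 0) P P

/-- A measurable odd function into `[-1, 1]`, on the whole line so that composition with the margins
needs no range condition. -/
structure IsRule (g : ℝ → ℝ) : Prop where
  meas : Measurable g
  odd : ∀ x, g (-x) = -g x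
  bound : ∀ x, |g x| ≤ 1

/-- The mixed second moment `E[g(X₀) h(X₀)]`; for rules `g`, `h` it is a covariance. -/
noncomputable def crossMoment (P : Measure Ω) (X : ℕ → Ω → ℝ) (g h : ℝ → ℝ) : ℝ :=
  ∫ ω, g (X 0 ω) * h (X 0 ω) ∂P

/-- The sum of the values of the rule `g` at the first `n` margins with weights `w`. -/
def weightedSum (w : ℕ → ℝ) (g : ℝ → ℝ) (X : ℕ → Ω → ℝ) (n : ℕ) (ω : Ω) : ℝ :=
  ∑ i ∈ Finset.range n, w i * g (X i ω)

/-- The standard deviation of `weightedSum w g X n`, in closed form. -/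
noncomputable def weightedSD (P : Measure Ω) (w : ℕ → ℝ) (g : ℝ → ℝ) (X : ℕ → Ω → ℝ) (n : ℕ) : ℝ :=
  √(crossMoment P X g g * ∑ i ∈ Finset.range n, w i ^ 2)

theorem measurable_weightedSum {X : ℕ → Ω → ℝ} (hX : ∀ i, Measurable (X i)) {g : ℝ → ℝ}
    (hg : Measurable g) (w : ℕ → ℝ) (n : ℕ) : Measurable (weightedSum w g X n) :=
  Finset.measurable_fun_sum _ fun i _ => (hg.comp (hX i)).const_mul (w i)

namespace IsMarginSeq

variable {X : ℕ → Ω → ℝ} {g h : ℝ → ℝ}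

omit [IsProbabilityMeasure P] in
theorem integral_comp (hX : IsMarginSeq P X) {f : ℝ → ℝ} (hf : Measurable f) (i : ℕ) :
    ∫ ω, f (X i ω) ∂P = ∫ ω, f (X 0 ω) ∂P :=
  ((hX.ident i).comp hf).integral_eq

omit [IsProbabilityMeasure P] in
theorem integral_rule (hX : IsMarginSeq P X) (hg : IsRule g) (i : ℕ) :
    ∫ ω, g (X i ω) ∂P = 0 := by
  rw [hX.integral_comp hg.meas i]
  have := (hX.symm.comp hg.meas).integral_eq
  simp only [Function.comp_def, hg.odd, integral_neg] at this
  linarith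

theorem integrable_mul (hX : IsMarginSeq P X) (hg : IsRule g) (hh : IsRule h) (i : ℕ) :
    Integrable (fun ω => g (X i ω) * h (X i ω)) P := by
  refine Integrable.of_bound ((hg.meas.comp (hX.meas i)).mul
    (hh.meas.comp (hX.meas i))).aestronglyMeasurable 1 (ae_of_all _ fun ω => ?_)
  rw [norm_mul, Real.norm_eq_abs, Real.norm_eq_abs]
  exact mul_le_one₀ (hg.bound _) (abs_nonneg _) (hh.bound _)

theorem memLp_rule (hX : IsMarginSeq P X) (hg : IsRule g) (i : ℕ) :
    MemLp (fun ω => g (X i ω)) 2 P :=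
  MemLp.of_bound (hg.meas.comp (hX.meas i)).aestronglyMeasurable 1 (ae_of_all _ fun _ => hg.bound _)

theorem memLp_weighted (hX : IsMarginSeq P X) (hg : IsRule g) (w : ℕ → ℝ) (J : Finset ℕ) :
    MemLp (fun ω => ∑ i ∈ J, w i * g (X i ω)) 2 P :=
  memLp_finsetSum _ fun i _ => (hX.memLp_rule hg i).const_mul (w i)

theorem integral_sq_weighted (hX : IsMarginSeq P X) (hg : IsRule g) (w : ℕ → ℝ) (J : Finset ℕ) :
    ∫ ω, (∑ i ∈ J, w i * g (X i ω)) ^ 2 ∂P = crossMoment P X g g * ∑ i ∈ J, w i ^ 2 := by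
  have hmean : ∀ i, ∫ ω, w i * g (X i ω) ∂P = 0 := fun i => by
    rw [integral_const_mul, hX.integral_rule hg, mul_zero]
  have hL : ∀ i, MemLp (fun ω => w i * g (X i ω)) 2 P := fun i =>
    (hX.memLp_rule hg i).const_mul (w i)
  have hind : iIndepFun (fun i ω => w i * g (X i ω)) P :=
    hX.indep.comp (fun i x => w i * g x) fun i => hg.meas.const_mul (w i)
  have h1 := IndepFun.variance_sum (X := fun i ω => w i * g (X i ω)) (s := J) (μ := P)
    (fun i _ => hL i) (fun i _ j _ hij => hind.indepFun hij)
  have hfun : (∑ i ∈ J, fun ω => w i * g (X i ω)) = fun ω => ∑ i ∈ J, w i * g (X i ω) := by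
    ext ω; simp
  have h0 : ∫ ω, ∑ i ∈ J, w i * g (X i ω) ∂P = 0 := by
    rw [integral_finsetSum _ fun i _ => (hL i).integrable (by norm_num)]
    exact Finset.sum_eq_zero fun i _ => hmean i
  have hm : ∀ i, Measurable fun ω => w i * g (X i ω) := fun i =>
    (hg.meas.comp (hX.meas i)).const_mul (w i)
  rw [hfun, variance_eq_integral (Finset.measurable_fun_sum _ fun i _ => hm i).aemeasurable,
    h0] at h1
  simp only [sub_zero] at h1
  rw [h1, Finset.mul_sum]
  refine Finset.sum_congr rfl fun i _ => ?_
  rw [variance_eq_integral (hm i).aemeasurable, hmean i]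
  simp only [sub_zero, mul_pow]
  rw [integral_const_mul, hX.integral_comp (f := fun x => g x ^ 2) (hg.meas.pow_const 2), crossMoment]
  simp only [sq]
  ring

theorem integral_sq_pair (hX : IsMarginSeq P X) (hg : IsRule g) (hh : IsRule h) (b c : ℝ) (i : ℕ) :
    ∫ ω, (b * g (X i ω) + c * h (X i ω)) ^ 2 ∂P
      = b ^ 2 * crossMoment P X g g + 2 * (b * c) * crossMoment P X g h
        + c ^ 2 * crossMoment P X h h := by
  have e : ∀ x : ℝ, (b * g x + c * h x) ^ 2
      = b ^ 2 * (g x * g x) + 2 * (b * c) * (g x * h x) + c ^ 2 * (h x * h x) := fun x => by ring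
  have hm : Measurable fun x => (b * g x + c * h x) ^ 2 :=
    ((hg.meas.const_mul b).add (hh.meas.const_mul c)).pow_const 2
  rw [hX.integral_comp hm i]
  simp_rw [e]
  have i1 := (hX.integrable_mul hg hg 0).const_mul (b ^ 2)
  have i2 := (hX.integrable_mul hg hh 0).const_mul (2 * (b * c))
  have i3 := (hX.integrable_mul hh hh 0).const_mul (c ^ 2)
  have i12 : Integrable (fun ω => b ^ 2 * (g (X 0 ω) * g (X 0 ω))
    + 2 * (b * c) * (g (X 0 ω) * h (X 0 ω))) P := i1.add i2
  rw [integral_add i12 i3, integral_add i1 i2, integral_const_mul, integral_const_mul,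
    integral_const_mul]
  rfl

end IsMarginSeq

/-- The standardized pair of weighted sums, as a complex number. -/
noncomputable def stdPair (P : Measure Ω) (s a : ℕ → ℝ) (f g : ℝ → ℝ) (X : ℕ → Ω → ℝ) (n : ℕ)
    (ω : Ω) : ℂ :=
  ⟨weightedSum s f X n ω / weightedSD P s f X n, weightedSum a g X n ω / weightedSD P a g X n⟩

omit [IsProbabilityMeasure P] in
theorem measurable_stdPair {X : ℕ → Ω → ℝ} (hX : IsMarginSeq P X) {f g : ℝ → ℝ} (hf : IsRule f)
    (hg : IsRule g) (s a : ℕ → ℝ) (n : ℕ) : Measurable (stdPair P s a f g X n) := by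
  have : stdPair P s a f g X n = fun ω =>
      ((weightedSum s f X n ω / weightedSD P s f X n : ℝ) : ℂ)
      + ((weightedSum a g X n ω / weightedSD P a g X n : ℝ) : ℂ) * Complex.I := by
    funext p
    apply Complex.ext <;> simp [stdPair]
  rw [this]
  have h1 := measurable_weightedSum hX.meas hf.meas s n
  have h2 := measurable_weightedSum hX.meas hg.meas a n
  fun_prop

/-- The law of the standardized pair. -/
noncomputable def stdPairLaw {X : ℕ → Ω → ℝ} (hX : IsMarginSeq P X) {f g : ℝ → ℝ} (hf : IsRule f)
    (hg : IsRule g) (s a : ℕ → ℝ) (n : ℕ) : ProbabilityMeasure ℂ :=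
  ⟨P.map (stdPair P s a f g X n),
    Measure.isProbabilityMeasure_map (measurable_stdPair hX hf hg s a n).aemeasurable⟩

/-- The correlation of the two weighted sums, in closed form; it is `0` if one of them has variance
`0`. -/
noncomputable def pairCorr (P : Measure Ω) (s a : ℕ → ℝ) (f g : ℝ → ℝ) (X : ℕ → Ω → ℝ) (n : ℕ) :
    ℝ :=
  crossMoment P X f g * (∑ i ∈ Finset.range n, s i * a i)
    / (weightedSD P s f X n * weightedSD P a g X n)

section CLT

variable {X : ℕ → Ω → ℝ} {f g : ℝ → ℝ} {s a : ℕ → ℝ}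

theorem weightedSD_sq (P : Measure Ω) (w : ℕ → ℝ) (g : ℝ → ℝ) (X : ℕ → Ω → ℝ) (n : ℕ) :
    weightedSD P w g X n ^ 2 = crossMoment P X g g * ∑ i ∈ Finset.range n, w i ^ 2 :=
  Real.sq_sqrt (mul_nonneg (integral_nonneg fun _ => mul_self_nonneg _)
    (Finset.sum_nonneg fun _ _ => sq_nonneg _))

omit [IsProbabilityMeasure P] in
theorem tendsto_weightedSD (hg0 : 0 < crossMoment P X g g)
    (ha : Tendsto (fun n => ∑ i ∈ Finset.range n, a i ^ 2) atTop atTop) :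
    Tendsto (weightedSD P a g X) atTop atTop :=
  Real.tendsto_sqrt_atTop.comp (ha.const_mul_atTop hg0)

theorem sum_integral_sq_pair (hX : IsMarginSeq P X) (hf : IsRule f) (hg : IsRule g) {n : ℕ}
    (hs : 0 < weightedSD P s f X n) (ha : 0 < weightedSD P a g X n) (u v : ℝ) :
    ∑ i ∈ Finset.range n, ∫ ω, (u * (s i / weightedSD P s f X n) * f (X i ω)
        + v * (a i / weightedSD P a g X n) * g (X i ω)) ^ 2 ∂P
      = u ^ 2 + 2 * pairCorr P s a f g X n * u * v + v ^ 2 := by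
  have h1 := weightedSD_sq P s f X n
  have h2 := weightedSD_sq P a g X n
  simp_rw [hX.integral_sq_pair hf hg]
  rw [Finset.sum_add_distrib, Finset.sum_add_distrib]
  have e1 : ∑ i ∈ Finset.range n, (u * (s i / weightedSD P s f X n)) ^ 2 * crossMoment P X f f
      = u ^ 2 := by
    rw [← Finset.sum_mul]
    simp_rw [mul_pow, div_pow]
    rw [← Finset.mul_sum, ← Finset.sum_div, mul_assoc, div_mul_eq_mul_div,
      mul_comm _ (crossMoment P X f f), ← h1, div_self (by positivity), mul_one]
  have e2 : ∑ i ∈ Finset.range n, (v * (a i / weightedSD P a g X n)) ^ 2 * crossMoment P X g g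
      = v ^ 2 := by
    rw [← Finset.sum_mul]
    simp_rw [mul_pow, div_pow]
    rw [← Finset.mul_sum, ← Finset.sum_div, mul_assoc, div_mul_eq_mul_div,
      mul_comm _ (crossMoment P X g g), ← h2, div_self (by positivity), mul_one]
  rw [e1, e2, pairCorr, Finset.mul_sum, Finset.sum_div, Finset.mul_sum, Finset.sum_mul,
    Finset.sum_mul]
  congr 2
  refine Finset.sum_congr rfl fun i _ => ?_
  field_simp

/-- The correlation is at most one in absolute value: the sum and the difference of the two
standardized sums have nonnegative variances `2 ± 2 * pairCorr`. -/
theorem abs_pairCorr_le_one (hX : IsMarginSeq P X) (hf : IsRule f) (hg : IsRule g) {n : ℕ}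
    (hs : 0 < weightedSD P s f X n) (ha : 0 < weightedSD P a g X n) :
    |pairCorr P s a f g X n| ≤ 1 := by
  have h1 := sum_integral_sq_pair hX hf hg hs ha 1 1
  have h2 := sum_integral_sq_pair hX hf hg hs ha 1 (-1)
  have p1 : 0 ≤ (1:ℝ) ^ 2 + 2 * pairCorr P s a f g X n * 1 * 1 + 1 ^ 2 := by
    rw [← h1]; exact Finset.sum_nonneg fun i _ => integral_nonneg fun _ => sq_nonneg _
  have p2 : 0 ≤ (1:ℝ) ^ 2 + 2 * pairCorr P s a f g X n * 1 * (-1) + (-1) ^ 2 := by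
    rw [← h2]; exact Finset.sum_nonneg fun i _ => integral_nonneg fun _ => sq_nonneg _
  rw [abs_le]
  constructor <;> linarith

theorem charFun_stdPairLaw (hX : IsMarginSeq P X) (hf : IsRule f) (hg : IsRule g) (n : ℕ) (t : ℂ) :
    charFun (stdPairLaw hX hf hg s a n : Measure ℂ) t
      = charFun (P.map (fun ω => ∑ i ∈ Finset.range n,
          (t.re * (s i / weightedSD P s f X n) * f (X i ω)
            + t.im * (a i / weightedSD P a g X n) * g (X i ω)))) 1 := by
  have hZ := measurable_stdPair hX hf hg s a n
  have hY : Measurable (fun ω => ∑ i ∈ Finset.range n,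
      (t.re * (s i / weightedSD P s f X n) * f (X i ω)
        + t.im * (a i / weightedSD P a g X n) * g (X i ω))) :=
    Finset.measurable_fun_sum _ fun i _ => ((hf.meas.comp (hX.meas i)).const_mul _).add
      ((hg.meas.comp (hX.meas i)).const_mul _)
  change charFun (P.map (stdPair P s a f g X n)) t = _
  rw [charFun_apply, charFun_apply, integral_map hZ.aemeasurable (by fun_prop),
    integral_map hY.aemeasurable (by fun_prop)]
  refine integral_congr_ae (ae_of_all _ fun ω => ?_)
  simp only
  congr 3
  rw [Complex.inner]
  simp only [stdPair, Complex.mul_re, Complex.conj_re, Complex.conj_im, weightedSum]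
  rw [Finset.sum_add_distrib, Finset.sum_div, Finset.sum_div, mul_neg, sub_neg_eq_add,
    Finset.mul_sum, Finset.mul_sum]
  simp only [inner, one_mul]
  congr 1 <;> refine Finset.sum_congr rfl fun i _ => ?_ <;> ring

/-- **Central limit theorem** for two weighted sums driven by the same margins: if both variances
diverge and the weights are bounded, then the standardized pair is asymptotically normal as soon as
the correlation converges. -/
theorem tendsto_stdPairLaw (hX : IsMarginSeq P X) (hf : IsRule f) (hg : IsRule g)
    (hf0 : 0 < crossMoment P X f f) (hg0 : 0 < crossMoment P X g g) {bs ba : ℝ}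
    (hsb : ∀ i, |s i| ≤ bs) (hab : ∀ i, |a i| ≤ ba)
    (hs : Tendsto (fun n => ∑ i ∈ Finset.range n, s i ^ 2) atTop atTop)
    (ha : Tendsto (fun n => ∑ i ∈ Finset.range n, a i ^ 2) atTop atTop) {κ : ℝ}
    (hκ : Tendsto (pairCorr P s a f g X) atTop (𝓝 κ)) :
    |κ| ≤ 1 ∧ Tendsto (stdPairLaw hX hf hg s a) atTop (𝓝 (correlatedGaussian κ)) := by
  have hS := tendsto_weightedSD (P := P) hf0 hs
  have hA := tendsto_weightedSD (P := P) hg0 ha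
  have hpos := (hS.eventually_gt_atTop 0).and (hA.eventually_gt_atTop 0)
  have hκ1 : |κ| ≤ 1 := le_of_tendsto hκ.abs (hpos.mono fun n hn =>
    abs_pairCorr_le_one hX hf hg hn.1 hn.2)
  refine ⟨hκ1, ProbabilityMeasure.tendsto_of_tendsto_charFun fun t => ?_⟩
  rw [charFun_correlatedGaussian hκ1]
  -- `ε n` bounds every summand of the linear combination with coefficients `t.re`, `t.im`, and
  -- `v n` is the variance of that combination
  set ε : ℕ → ℝ := fun n => |t.re| * (bs / weightedSD P s f X n)
    + |t.im| * (ba / weightedSD P a g X n) with hε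
  have hε0 : Tendsto ε atTop (𝓝 0) := by
    have h1 : Tendsto (fun n => bs / weightedSD P s f X n) atTop (𝓝 0) := hS.const_div_atTop bs
    have h2 : Tendsto (fun n => ba / weightedSD P a g X n) atTop (𝓝 0) := hA.const_div_atTop ba
    simpa using (h1.const_mul |t.re|).add (h2.const_mul |t.im|)
  set v : ℕ → ℝ := fun n => t.re ^ 2 + 2 * pairCorr P s a f g X n * t.re * t.im + t.im ^ 2 with hv
  have hvl : Tendsto v atTop (𝓝 (t.re ^ 2 + 2 * κ * t.re * t.im + t.im ^ 2)) :=
    ((((hκ.const_mul 2).mul_const t.re).mul_const t.im).const_add _).add_const _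
  have hbound : ∀ᶠ n in atTop, ‖charFun (stdPairLaw hX hf hg s a n : Measure ℂ) t
      - Complex.exp ((-(v n) / 2 : ℝ))‖ ≤ 2 * ε n * v n := by
    filter_upwards [hpos, hε0.eventually (ge_mem_nhds zero_lt_one)] with n hn hε1
    rw [charFun_stdPairLaw, hv]
    simp only
    rw [← sum_integral_sq_pair hX hf hg hn.1 hn.2]
    have hm : ∀ i, Measurable fun x : ℝ => t.re * (s i / weightedSD P s f X n) * f x
        + t.im * (a i / weightedSD P a g X n) * g x := fun i =>
      (hf.meas.const_mul _).add (hg.meas.const_mul _)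
    refine norm_charFun_sum_sub_exp_le (fun i => (hm i).comp (hX.meas i))
      (hX.indep.comp _ hm) hε1 (fun i _ ω => ?_) fun i => ?_
    · refine (abs_add_le _ _).trans ?_
      rw [abs_mul, abs_mul, abs_div, abs_mul, abs_mul, abs_div, abs_of_pos hn.1, abs_of_pos hn.2]
      have b1 : |s i| / weightedSD P s f X n ≤ bs / weightedSD P s f X n := by
        have := hn.1; have := hsb i; gcongr
      have b2 : |a i| / weightedSD P a g X n ≤ ba / weightedSD P a g X n := by
        have := hn.2; have := hab i; gcongr
      have n1 : 0 ≤ |s i| / weightedSD P s f X n := div_nonneg (abs_nonneg _) hn.1.le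
      have n2 : 0 ≤ |a i| / weightedSD P a g X n := div_nonneg (abs_nonneg _) hn.2.le
      refine add_le_add ?_ ?_
      · exact (mul_le_of_le_one_right (by positivity) (hf.bound _)).trans (by gcongr)
      · exact (mul_le_of_le_one_right (by positivity) (hg.bound _)).trans (by gcongr)
    · have i1 := ((hX.memLp_rule hf i).integrable (by norm_num)).const_mul
        (t.re * (s i / weightedSD P s f X n))
      have i2 := ((hX.memLp_rule hg i).integrable (by norm_num)).const_mul
        (t.im * (a i / weightedSD P a g X n))
      simp only [Function.comp_apply]
      rw [integral_add i1 i2, integral_const_mul, integral_const_mul, hX.integral_rule hf,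
        hX.integral_rule hg]
      simp
  have hz : Tendsto (fun n => 2 * ε n * v n) atTop (𝓝 0) := by
    simpa using (hε0.const_mul 2).mul hvl
  have h1 := squeeze_zero_norm' hbound hz
  have h2 : Tendsto (fun n => Complex.exp ((-(v n) / 2 : ℝ))) atTop
      (𝓝 (Complex.exp ((-(t.re ^ 2 + 2 * κ * t.re * t.im + t.im ^ 2) / 2 : ℝ)))) := by
    refine (Complex.continuous_exp.tendsto _).comp ((Complex.continuous_ofReal.tendsto _).comp ?_)
    exact hvl.neg.div_const 2
  simpa using h1.add h2

end CLT

end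

/-! ### Consequences of asymptotic normality -/

section

variable {Ω : Type*} [MeasurableSpace Ω] {P : Measure Ω} [IsProbabilityMeasure P]

section Replacement

variable {D D' U : Ω → ℝ}

/-- Changing the decision on an event of small probability has a small effect on the expected
product with a variable of second moment at most one. -/
theorem abs_integral_mul_sub_le (hD : Measurable D) (hD' : Measurable D')
    (h1 : ∀ᵐ ω ∂P, |D ω| ≤ 1) (h1' : ∀ᵐ ω ∂P, |D' ω| ≤ 1) (hU : MemLp U 2 P)
    (hU1 : ∫ ω, U ω ^ 2 ∂P ≤ 1) {M : ℝ} (hM : 0 < M) :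
    |∫ ω, D ω * U ω ∂P - ∫ ω, D' ω * U ω ∂P| ≤ M * P.real {ω | D ω ≠ D' ω} + 1 / M := by
  have hUi := hU.integrable (by norm_num)
  have hU2 : Integrable (fun ω => U ω ^ 2) P := hU.integrable_sq
  have i1 : Integrable (fun ω => D ω * U ω) P := hUi.bdd_mul hD.aestronglyMeasurable h1
  have i2 : Integrable (fun ω => D' ω * U ω) P := hUi.bdd_mul hD'.aestronglyMeasurable h1'
  set A := {ω | D ω ≠ D' ω} with hA
  have hAm : MeasurableSet A := (measurableSet_eq_fun hD hD').compl
  have hAi : Integrable (A.indicator fun _ => (1 : ℝ)) P :=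
    (integrable_const (1 : ℝ)).indicator hAm
  rw [← integral_sub i1 i2, ← Real.norm_eq_abs]
  refine (norm_integral_le_of_norm_le
    (g := fun ω => M * A.indicator (fun _ => (1 : ℝ)) ω + U ω ^ 2 / M)
    ((hAi.const_mul M).add (hU2.div_const M)) ?_).trans ?_
  · filter_upwards [h1, h1'] with ω k1 k1'
    rw [← sub_mul, norm_mul, Real.norm_eq_abs, Real.norm_eq_abs]
    by_cases h : ω ∈ A
    · rw [Set.indicator_of_mem h]
      have k : |D ω - D' ω| ≤ 2 := (abs_sub _ _).trans (by linarith)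
      -- the inequality of arithmetic and geometric means for `M` and `|U ω|² / M`
      have k2 : 2 * |U ω| ≤ M * 1 + U ω ^ 2 / M := by
        rw [← sq_abs (U ω), mul_one, ← sub_le_iff_le_add', le_div_iff₀ hM]
        nlinarith [sq_nonneg (|U ω| - M)]
      nlinarith [abs_nonneg (U ω)]
    · have : D ω = D' ω := by simpa [hA] using h
      rw [this, sub_self, abs_zero, zero_mul, Set.indicator_of_notMem h]
      positivity
  · rw [integral_add (hAi.const_mul M) (hU2.div_const M), integral_const_mul, integral_div,
      integral_indicator_const _ hAm, smul_eq_mul, mul_one]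
    gcongr

omit [IsProbabilityMeasure P] in
theorem abs_measureReal_sub_le [IsFiniteMeasure P] {A B C : Set Ω} (h1 : A ⊆ B ∪ C)
    (h2 : B ⊆ A ∪ C) : |P.real A - P.real B| ≤ P.real C := by
  have k1 := (measureReal_mono h1).trans (measureReal_union_le (μ := P) B C)
  have k2 := (measureReal_mono h2).trans (measureReal_union_le (μ := P) A C)
  rw [abs_le]; constructor <;> linarith

theorem abs_prob_mul_neg_sub_le :
    |P.real {ω | D ω * U ω < 0} - P.real {ω | D' ω * U ω < 0}| ≤ P.real {ω | D ω ≠ D' ω} := by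
  refine abs_measureReal_sub_le (fun ω hω => ?_) fun ω hω => ?_
  all_goals
    by_cases h : D ω = D' ω
    · left; simpa [h] using hω
    · right; exact h

end Replacement

section Limits

theorem ae_correlatedGaussian_re_ne_zero {κ : ℝ} (hκ : |κ| ≤ 1) :
    ∀ᵐ z ∂(correlatedGaussian κ : Measure ℂ), z.re ≠ 0 := by
  have hatom := nullSingletonClass_gaussianReal (μ := 0) (v := 1) one_ne_zero
  rw [coe_correlatedGaussian, ae_map_iff (measurable_correlatedPair κ).aemeasurable
    (by measurability)]
  simp only [correlatedPair]
  have hm : MeasurableSet {p : ℝ × ℝ | κ * p.1 + √(1 - κ ^ 2) * p.2 ≠ 0} :=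
    (measurableSet_eq_fun ((measurable_fst.const_mul _).add (measurable_snd.const_mul _))
      measurable_const).compl
  refine (Measure.ae_prod_iff_ae_ae hm).2 ?_
  filter_upwards [ae_gaussian_ne_zero] with x hx
  by_cases hl : √(1 - κ ^ 2) = 0
  · refine ae_of_all _ fun y => ?_
    have h1 : 1 - κ ^ 2 ≤ 0 := Real.sqrt_eq_zero'.1 hl
    have hκ0 : κ ≠ 0 := by rintro rfl; norm_num at h1
    simpa [hl] using ⟨hκ0, hx⟩
  · have : ∀ᵐ y ∂(gaussianReal 0 1), y ≠ -(κ * x) / √(1 - κ ^ 2) := by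
      rw [ae_iff]; simp
    filter_upwards [this] with y hy h
    exact hy (by rw [eq_div_iff hl]; linarith)

variable {X : ℕ → Ω → ℝ} {f g : ℝ → ℝ} {s a : ℕ → ℝ}

theorem sign_div_of_pos (x : ℝ) {y : ℝ} (hy : 0 < y) : Real.sign (x / y) = Real.sign x := by
  rcases lt_trichotomy x 0 with h | h | h
  · rw [Real.sign_of_neg h, Real.sign_of_neg (div_neg_of_neg_of_pos h hy)]
  · simp [h]
  · rw [Real.sign_of_pos h, Real.sign_of_pos (div_pos h hy)]

theorem integral_sq_standardized (hX : IsMarginSeq P X) (hf : IsRule f) {n : ℕ}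
    (hs : 0 < weightedSD P s f X n) :
    ∫ ω, (weightedSum s f X n ω / weightedSD P s f X n) ^ 2 ∂P = 1 := by
  simp_rw [div_pow]
  rw [integral_div]
  unfold weightedSum
  rw [hX.integral_sq_weighted hf, ← weightedSD_sq, div_self (by positivity)]

theorem memLp_standardized (hX : IsMarginSeq P X) (hf : IsRule f) (n : ℕ) :
    MemLp (fun ω => weightedSum s f X n ω / weightedSD P s f X n) 2 P := by
  simp_rw [div_eq_mul_inv]
  exact (hX.memLp_weighted hf s _).mul_const _

/-- The expected welfare of a decision by the sign of an asymptotically normal weighted sum. The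
function `z ↦ re z * sign (im z)` is discontinuous only on the real axis, a null set, and its second
moments are bounded by those of `re z`. -/
theorem tendsto_integral_mul_sign (hX : IsMarginSeq P X) (hf : IsRule f) (hg : IsRule g)
    (hS : Tendsto (weightedSD P s f X) atTop atTop)
    (hA : Tendsto (weightedSD P a g X) atTop atTop) {κ : ℝ}
    (hκ : Tendsto (stdPairLaw hX hf hg s a) atTop (𝓝 (correlatedGaussian κ))) :
    Tendsto (fun n => ∫ ω, Real.sign (weightedSum a g X n ω) *
      (weightedSum s f X n ω / weightedSD P s f X n) ∂P) atTop (𝓝 (√(2 / Real.pi) * κ)) := by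
  have hsg := measurable_sign
  have hφ : Measurable fun z : ℂ => z.re * Real.sign z.im := by fun_prop
  have hsq : ∀ z : ℂ, (z.re * Real.sign z.im) ^ 2 ≤ z.re ^ 2 := fun z => by
    rw [mul_pow]
    have : Real.sign z.im ^ 2 ≤ 1 := by
      rw [sq_le_one_iff_abs_le_one]; exact abs_sign_le_one _
    nlinarith [sq_nonneg z.re]
  have hsqi : ∀ μ : Measure ℂ, MemLp (fun z : ℂ => z.re) 2 μ →
      Integrable (fun z : ℂ => (z.re * Real.sign z.im) ^ 2) μ := fun μ hμ =>
    hμ.integrable_sq.mono (hφ.pow_const 2).aestronglyMeasurable (ae_of_all _ fun z => by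
      rw [Real.norm_of_nonneg (sq_nonneg _), Real.norm_of_nonneg (sq_nonneg _)]; exact hsq z)
  have hL : ∀ n, MemLp (fun z : ℂ => z.re) 2 (stdPairLaw hX hf hg s a n : Measure ℂ) := fun n => by
    have := memLp_standardized (s := s) hX hf n
    exact (memLp_map_measure_iff (by fun_prop)
      (measurable_stdPair hX hf hg s a n).aemeasurable).2 this
  have hG := memLp_correlatedGaussian_re κ
  have key := tendsto_integral_of_ae_continuousAt hκ hφ (C := max 1 (∫ z, z.re ^ 2
      ∂(correlatedGaussian κ : Measure ℂ))) ?_ (hsqi _ hG)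
    ((integral_mono (hsqi _ hG) hG.integrable_sq hsq).trans (le_max_right _ _))
    (Eventually.of_forall fun n => hsqi _ (hL n)) ?_
  · rw [integral_re_mul_sign_im] at key
    refine key.congr' ?_
    filter_upwards [hA.eventually_gt_atTop 0] with n hn
    change ∫ z, _ ∂(P.map (stdPair P s a f g X n)) = _
    rw [integral_map (measurable_stdPair hX hf hg s a n).aemeasurable hφ.aestronglyMeasurable]
    refine integral_congr_ae (ae_of_all _ fun ω => ?_)
    simp only [stdPair]
    rw [sign_div_of_pos _ hn, mul_comm]
  · filter_upwards [ae_correlatedGaussian_im_ne_zero κ] with z hz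
    refine Complex.continuous_re.continuousAt.mul ?_
    rcases lt_or_gt_of_ne hz with h | h
    · refine (continuousAt_const (y := (-1 : ℝ))).congr ?_
      filter_upwards [Complex.continuous_im.continuousAt.eventually (gt_mem_nhds h)] with w hw
      rw [Real.sign_of_neg hw]
    · refine (continuousAt_const (y := (1 : ℝ))).congr ?_
      filter_upwards [Complex.continuous_im.continuousAt.eventually (lt_mem_nhds h)] with w hw
      rw [Real.sign_of_pos hw]
  · filter_upwards [hS.eventually_gt_atTop 0] with n hn
    refine (integral_mono (hsqi _ (hL n)) (hL n).integrable_sq hsq).trans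
      (le_trans (le_of_eq ?_) (le_max_left _ _))
    change ∫ z, _ ∂(P.map (stdPair P s a f g X n)) = _
    rw [integral_map (measurable_stdPair hX hf hg s a n).aemeasurable (by fun_prop)]
    exact integral_sq_standardized hX hf hn

/-- Under asymptotic normality, the second coordinate has vanishing probability of lying in any
fixed bounded interval, before standardization. -/
theorem tendsto_prob_abs_le (hX : IsMarginSeq P X) (hf : IsRule f) (hg : IsRule g)
    (hA : Tendsto (weightedSD P a g X) atTop atTop) {κ : ℝ}
    (hκ : Tendsto (stdPairLaw hX hf hg s a) atTop (𝓝 (correlatedGaussian κ))) (K : ℝ) :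
    Tendsto (fun n => P.real {ω | |weightedSum a g X n ω| ≤ K}) atTop (𝓝 0) := by
  set ν : Measure ℂ := (correlatedGaussian κ : Measure ℂ) with hν
  have hcl : ∀ δ : ℝ, IsClosed {z : ℂ | |z.im| ≤ δ} := fun δ =>
    isClosed_le (Complex.continuous_im.abs) continuous_const
  have hsmall : Tendsto (ν ∘ fun δ : ℝ => {z : ℂ | |z.im| ≤ δ}) (𝓝[>] 0) (𝓝 0) := by
    have h := tendsto_measure_biInter_gt (μ := ν) (s := fun δ : ℝ => {z : ℂ | |z.im| ≤ δ}) (a := 0)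
      (fun δ _ => (hcl δ).measurableSet.nullMeasurableSet)
      (fun i j _ hij z hz => le_trans hz hij) ⟨1, one_pos, measure_ne_top _ _⟩
    have e : ν (⋂ δ > (0 : ℝ), {z : ℂ | |z.im| ≤ δ}) = 0 := by
      refine measure_mono_null (fun z hz => ?_) (ae_iff.1 (ae_correlatedGaussian_im_ne_zero κ))
      simp only [Set.mem_iInter, Set.mem_ofPred_eq, not_not] at hz ⊢
      exact abs_nonpos_iff.1 (le_of_forall_gt_imp_ge_of_dense hz)
    rwa [e] at h
  have hE : Tendsto (fun n => P {ω | |weightedSum a g X n ω| ≤ K}) atTop (𝓝 0) := by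
    rw [ENNReal.tendsto_nhds_zero]
    intro ε hε
    obtain ⟨δ, hδ, hδ0⟩ := ((hsmall.eventually (gt_mem_nhds hε)).and self_mem_nhdsWithin).exists
    have hδ0 : 0 < δ := hδ0
    have h1 := (ProbabilityMeasure.limsup_measure_closed_le_of_tendsto hκ (hcl δ)).trans_lt hδ
    filter_upwards [eventually_lt_of_limsup_lt h1, (hA.const_div_atTop K).eventually
      (gt_mem_nhds hδ0), hA.eventually_gt_atTop 0] with n hn hn2 hn3
    refine le_trans ?_ hn.le
    change _ ≤ P.map (stdPair P s a f g X n) _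
    rw [Measure.map_apply (measurable_stdPair hX hf hg s a n) (hcl δ).measurableSet]
    refine measure_mono fun ω hω => ?_
    simp only [stdPair, Set.mem_preimage, Set.mem_ofPred_eq] at hω ⊢
    rw [abs_div, abs_of_pos hn3]
    exact le_trans (by gcongr) hn2.le
  simpa [measureReal_def, Function.comp_def] using (ENNReal.tendsto_toReal ENNReal.zero_ne_top).comp hE

theorem tendsto_prob_mul_neg (hX : IsMarginSeq P X) (hf : IsRule f) (hg : IsRule g)
    (hA : Tendsto (weightedSD P a g X) atTop atTop) {κ : ℝ} (hκ1 : |κ| ≤ 1)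
    (hκ : Tendsto (stdPairLaw hX hf hg s a) atTop (𝓝 (correlatedGaussian κ))) :
    Tendsto (fun n => P.real {ω | Real.sign (weightedSum a g X n ω) *
      (weightedSum s f X n ω / weightedSD P s f X n) < 0}) atTop
      (𝓝 (Real.arccos κ / Real.pi)) := by
  have hopen : IsOpen {z : ℂ | z.re * z.im < 0} :=
    isOpen_lt (Complex.continuous_re.mul Complex.continuous_im) continuous_const
  have hfr : (correlatedGaussian κ : Measure ℂ) (frontier {z : ℂ | z.re * z.im < 0}) = 0 := by
    refine measure_mono_null (frontier_lt_subset_eq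
      (Complex.continuous_re.mul Complex.continuous_im) continuous_const) ?_
    have : ∀ᵐ z ∂(correlatedGaussian κ : Measure ℂ), z.re * z.im ≠ 0 := by
      filter_upwards [ae_correlatedGaussian_re_ne_zero hκ1, ae_correlatedGaussian_im_ne_zero κ]
        with z h1 h2 using mul_ne_zero h1 h2
    refine measure_mono_null (fun z hz => ?_) (ae_iff.1 this)
    exact not_not.2 hz
  have h1 := ProbabilityMeasure.tendsto_measure_of_null_frontier_of_tendsto' hκ hfr
  have h2 := (ENNReal.tendsto_toReal (measure_ne_top _ _)).comp h1
  rw [← measureReal_def, correlatedGaussian_re_mul_im_neg hκ1] at h2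
  refine h2.congr' ?_
  filter_upwards [hA.eventually_gt_atTop 0] with n hn
  change (P.map (stdPair P s a f g X n) _).toReal = _
  rw [Measure.map_apply (measurable_stdPair hX hf hg s a n) hopen.measurableSet, measureReal_def]
  congr 2
  ext ω
  simp only [stdPair, Set.mem_preimage, Set.mem_ofPred_eq]
  rw [← sign_div_of_pos (weightedSum a g X n ω) hn]
  generalize weightedSum s f X n ω / weightedSD P s f X n = u
  generalize weightedSum a g X n ω / weightedSD P a g X n = v
  rcases lt_trichotomy v 0 with h | h | h
  · rw [Real.sign_of_neg h, mul_neg_iff]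
    constructor
    · rintro (⟨h1, _⟩ | ⟨_, h2⟩) <;> linarith
    · intro h1; left; exact ⟨by linarith, h⟩
  · simp [h]
  · rw [Real.sign_of_pos h, one_mul]
    exact ⟨fun h1 => by by_contra! h2; linarith [mul_nonneg h2 h.le],
      fun h1 => mul_neg_of_neg_of_pos h1 h⟩

end Limits

end

/-! ### Anticoncentration for square-summable weights -/

section

variable {Ω : Type*} [MeasurableSpace Ω] {P : Measure Ω} [IsProbabilityMeasure P]

section Anticoncentration

omit [IsProbabilityMeasure P] in
/-- Concentration bound for a sum of two independent variables, restricted to an event determined by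
the first. -/
theorem measure_add_near_le [IsFiniteMeasure P] {U V : Ω → ℝ} (hU : Measurable U) (hV : Measurable V)
    (hUV : IndepFun U V P) {B : Set ℝ} (hB : MeasurableSet B) {ε : ℝ} {q : ENNReal}
    (hq : ∀ y, P {ω | |V ω - y| ≤ ε} ≤ q) (x : ℝ) :
    P {ω | U ω ∈ B ∧ |U ω + V ω - x| ≤ ε} ≤ q * P {ω | U ω ∈ B} := by
  have hm : MeasurableSet {p : ℝ × ℝ | p.1 ∈ B ∧ |p.1 + p.2 - x| ≤ ε} :=
    (measurable_fst hB).inter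
      (measurableSet_le ((measurable_fst.add measurable_snd).sub_const x).abs measurable_const)
  have e1 : P {ω | U ω ∈ B ∧ |U ω + V ω - x| ≤ ε}
      = (P.map fun ω => (U ω, V ω)) {p : ℝ × ℝ | p.1 ∈ B ∧ |p.1 + p.2 - x| ≤ ε} := by
    rw [Measure.map_apply (hU.prodMk hV) hm]; rfl
  rw [e1, hUV.map_prod_eq_prod_map_map hU.aemeasurable hV.aemeasurable, Measure.prod_apply hm]
  calc _ ≤ ∫⁻ u, B.indicator (fun _ => q) u ∂(P.map U) := by
        refine lintegral_mono fun u => ?_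
        by_cases hu : u ∈ B
        · rw [Set.indicator_of_mem hu, Measure.map_apply hV (measurable_prodMk_left hm)]
          refine le_trans (measure_mono fun ω hω => ?_) (hq (x - u))
          have : |u + V ω - x| ≤ ε := hω.2
          rw [Set.mem_ofPred_eq]
          rwa [show V ω - (x - u) = u + V ω - x by ring]
        · have : Prod.mk u ⁻¹' {p : ℝ × ℝ | p.1 ∈ B ∧ |p.1 + p.2 - x| ≤ ε} = ∅ := by
            ext v; simp [hu]
          rw [this]; simp
    _ = q * P {ω | U ω ∈ B} := by
        rw [lintegral_indicator_const hB, Measure.map_apply hU hB]; rfl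

variable {X : ℕ → Ω → ℝ} {g : ℝ → ℝ} {a : ℕ → ℝ}

/-- A symmetric nonzero variable stays away from any point at a definite scale with a definite
probability. -/
theorem exists_single_concentration (hX : IsMarginSeq P X) (hg : IsRule g)
    (hg0 : 0 < crossMoment P X g g) :
    ∃ η > 0, ∃ θ < (1 : ENNReal), ∀ i x, P {ω | |g (X i ω) - x| ≤ η} ≤ θ := by
  have hm0 : Measurable fun ω => g (X 0 ω) := hg.meas.comp (hX.meas 0)
  obtain ⟨η, hη, hp⟩ : ∃ η > 0, P {ω | 2 * η ≤ g (X 0 ω)} ≠ 0 := by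
    -- otherwise `g (X 0) ≤ 0` almost surely, hence `g (X 0) = 0` by symmetry
    by_contra! h
    have hle : ∀ᵐ ω ∂P, g (X 0 ω) ≤ 0 := by
      have : ∀ᵐ ω ∂P, ∀ k : ℕ, ¬ (2 * (1 / ((k : ℝ) + 1)) ≤ g (X 0 ω)) := by
        rw [ae_all_iff]
        intro k
        rw [ae_iff]
        simpa using h (1 / ((k : ℝ) + 1)) (by positivity)
      filter_upwards [this] with ω hω
      by_contra! hpos
      obtain ⟨k, hk⟩ := exists_nat_one_div_lt (half_pos hpos)
      exact hω k (by linarith)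
    have hge : ∀ᵐ ω ∂P, 0 ≤ g (X 0 ω) := by
      have := hX.symm.symm.ae_snd (p := fun x => g x ≤ 0)
        (measurableSet_le hg.meas measurable_const) hle
      filter_upwards [this] with ω hω
      have : g (-X 0 ω) ≤ 0 := hω
      rw [hg.odd] at this; linarith
    have : crossMoment P X g g = 0 := by
      rw [crossMoment, integral_eq_zero_of_ae]
      filter_upwards [hle, hge] with ω h1 h2
      simp [le_antisymm h1 h2]
    linarith
  have hsym : P {ω | g (X 0 ω) ≤ -(2 * η)} = P {ω | 2 * η ≤ g (X 0 ω)} := by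
    have := hX.symm.measure_mem_eq (s := {x | 2 * η ≤ g x}) (measurableSet_le measurable_const hg.meas)
    refine Eq.trans ?_ this
    congr 1
    ext ω
    simp only [Set.mem_ofPred_eq, Set.mem_preimage, hg.odd]
    constructor <;> intro h <;> linarith
  refine ⟨η, hη, 1 - P {ω | 2 * η ≤ g (X 0 ω)},
    ENNReal.sub_lt_self ENNReal.one_ne_top one_ne_zero hp, fun i x => ?_⟩
  have hi : P {ω | |g (X i ω) - x| ≤ η} = P {ω | |g (X 0 ω) - x| ≤ η} :=
    (hX.ident i).measure_mem_eq (s := {y | |g y - x| ≤ η})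
      (measurableSet_le ((hg.meas.sub_const x).abs) measurable_const)
  rw [hi]
  rcases le_total 0 x with hx | hx
  · rw [← hsym, ← prob_compl_eq_one_sub (measurableSet_le hm0 measurable_const)]
    refine measure_mono fun ω hω => ?_
    have := abs_le.1 (show |g (X 0 ω) - x| ≤ η from hω)
    simp only [Set.mem_compl_iff, Set.mem_ofPred_eq, not_le]
    linarith
  · rw [← prob_compl_eq_one_sub (measurableSet_le measurable_const hm0)]
    refine measure_mono fun ω hω => ?_
    have := abs_le.1 (show |g (X 0 ω) - x| ≤ η from hω)
    simp only [Set.mem_compl_iff, Set.mem_ofPred_eq, not_le]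
    linarith

omit [IsProbabilityMeasure P] in
theorem measurable_finset_weighted (hX : IsMarginSeq P X) (hg : IsRule g) (a : ℕ → ℝ)
    (J : Finset ℕ) : Measurable fun ω => ∑ i ∈ J, a i * g (X i ω) :=
  Finset.measurable_fun_sum _ fun i _ => (hg.meas.comp (hX.meas i)).const_mul (a i)

omit [IsProbabilityMeasure P] in
theorem indepFun_finset_weighted (hX : IsMarginSeq P X) (hg : IsRule g) (a : ℕ → ℝ)
    {J K : Finset ℕ} (h : Disjoint J K) :
    IndepFun (fun ω => ∑ i ∈ J, a i * g (X i ω)) (fun ω => ∑ i ∈ K, a i * g (X i ω)) P := by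
  have hm : ∀ S : Finset ℕ, Measurable fun x : S → ℝ => ∑ i : S, a i * g (x i) := fun S =>
    Finset.measurable_fun_sum _ fun i _ => (hg.meas.comp (measurable_pi_apply i)).const_mul _
  have := (hX.indep.indepFun_finset J K h hX.meas).comp (hm J) (hm K)
  have e : ∀ S : Finset ℕ, (fun ω => ∑ i ∈ S, a i * g (X i ω))
      = (fun x : S → ℝ => ∑ i : S, a i * g (x i)) ∘ fun ω (i : S) => X i ω := fun S => by
    ext ω
    exact (Finset.sum_coe_sort S fun i => a i * g (X i ω)).symm
  rw [e J, e K]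
  exact this

/-- If arbitrarily small positive weights occur, then a rapidly decreasing selection of them makes
the weighted sum spread out: resolving one summand at a time, each costs a factor `θ`. -/
theorem exists_lacunary (hX : IsMarginSeq P X) (hg : IsRule g) {η : ℝ} (hη : 0 < η) {θ : ENNReal}
    (hθ : ∀ i x, P {ω | |g (X i ω) - x| ≤ η} ≤ θ)
    (ha : ∀ δ > 0, ∀ N, ∃ i ≥ N, 0 < a i ∧ a i ≤ δ) (m : ℕ) :
    ∀ δ > 0, ∀ N : ℕ, ∃ J : Finset ℕ, (∀ i ∈ J, N ≤ i) ∧ (∑ i ∈ J, |a i| ≤ δ) ∧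
      ∃ ε > 0, ε ≤ δ ∧ ∀ x, P {ω | |∑ i ∈ J, a i * g (X i ω) - x| ≤ ε} ≤ θ ^ m := by
  induction m with
  | zero =>
    intro δ hδ N
    exact ⟨∅, by simp, by simpa using hδ.le, δ, hδ, le_rfl, fun x => by simpa using prob_le_one⟩
  | succ m ih =>
    intro δ hδ N
    obtain ⟨j, hjN, hj0, hjδ⟩ := ha (δ / 2) (half_pos hδ) N
    obtain ⟨J, hJN, hJδ, ε, hε, hεδ, hJ⟩ := ih (min (δ / 2) (a j * η / 2)) (by positivity) (j + 1)
    have hjJ : j ∉ J := fun h => by have := hJN j h; omega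
    refine ⟨insert j J, ?_, ?_, ε, hε, ?_, fun x => ?_⟩
    · intro i hi
      rcases Finset.mem_insert.1 hi with rfl | hi
      · exact hjN
      · have := hJN i hi; omega
    · rw [Finset.sum_insert hjJ, abs_of_pos hj0]
      linarith [hJδ.trans (min_le_left _ _)]
    · linarith [hεδ.trans (min_le_left _ _)]
    · -- the later summands total at most `a j * η / 2`, so the sum is near `x` only if
      -- `a j * g (X j)` is within `a j * η` of `x`
      have hind := indepFun_finset_weighted hX hg a (J := {j}) (K := J) (by simpa using hjJ)
      simp only [Finset.sum_singleton] at hind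
      have hB : MeasurableSet {u : ℝ | |u - x| ≤ a j * η} :=
        measurableSet_le (by fun_prop) measurable_const
      have h1 := measure_add_near_le ((hg.meas.comp (hX.meas j)).const_mul (a j))
        (measurable_finset_weighted hX hg a J) hind hB hJ x
      rw [pow_succ]
      refine le_trans (measure_mono fun ω hω => ?_) (h1.trans ?_)
      · have hω : |∑ i ∈ insert j J, a i * g (X i ω) - x| ≤ ε := hω
        rw [Finset.sum_insert hjJ] at hω
        refine ⟨?_, hω⟩
        have hV : |∑ i ∈ J, a i * g (X i ω)| ≤ a j * η / 2 := by
          refine ((Finset.abs_sum_le_sum_abs _ _).trans (Finset.sum_le_sum fun i _ => ?_)).trans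
            (hJδ.trans (min_le_right _ _))
          rw [abs_mul]
          exact mul_le_of_le_one_right (abs_nonneg _) (hg.bound _)
        have hε2 := hεδ.trans (min_le_right _ _)
        simp only [Set.mem_ofPred_eq, Function.comp_apply]
        rw [abs_le] at hV hω ⊢
        constructor <;> linarith [hV.1, hV.2, hω.1, hω.2]
      · gcongr
        refine le_trans (measure_mono fun ω hω => ?_) (hθ j (x / a j))
        have hω : |a j * g (X j ω) - x| ≤ a j * η := hω
        have e : a j * g (X j ω) - x = a j * (g (X j ω) - x / a j) := by field_simp
        rw [e, abs_mul, abs_of_pos hj0] at hω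
        exact le_of_mul_le_mul_left hω hj0

/-- Anticoncentration: if infinitely many weights are positive and the weights tend to zero, the
partial weighted sums put uniformly little mass near zero. -/
theorem exists_anticoncentration (hX : IsMarginSeq P X) (hg : IsRule g)
    (hg0 : 0 < crossMoment P X g g) (ha0 : ∀ i, 0 ≤ a i) (hat : Tendsto a atTop (𝓝 0))
    (hinf : ∀ N, ∃ i ≥ N, a i ≠ 0) {ε : ENNReal} (hε : 0 < ε) :
    ∃ δ > 0, ∃ k₀, ∀ k ≥ k₀, P {ω | |weightedSum a g X k ω| ≤ δ} ≤ ε := by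
  obtain ⟨η, hη, θ, hθ1, hθ⟩ := exists_single_concentration hX hg hg0
  have hlim : Tendsto (fun m => θ ^ m) atTop (𝓝 0) := ENNReal.tendsto_pow_atTop_nhds_zero_of_lt_one hθ1
  obtain ⟨m, hm⟩ := (hlim.eventually (ge_mem_nhds hε)).exists
  obtain ⟨J, -, -, δ, hδ, -, hJ⟩ := exists_lacunary hX hg hη hθ (a := a) (fun δ hδ N => by
    obtain ⟨N', hN'⟩ := eventually_atTop.1 (hat.eventually (ge_mem_nhds hδ))
    obtain ⟨i, hi, hia⟩ := hinf (max N N')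
    exact ⟨i, le_trans (le_max_left _ _) hi, lt_of_le_of_ne (ha0 i) hia.symm,
      hN' i (le_trans (le_max_right _ _) hi)⟩) m 1 one_pos 0
  refine ⟨δ, hδ, J.sup id + 1, fun k hk => ?_⟩
  have hsub : J ⊆ Finset.range k := fun i hi => by
    have : i ≤ J.sup id := Finset.le_sup (f := id) hi
    simp only [Finset.mem_range]; omega
  -- adding an independent variable does not increase concentration
  have hind := indepFun_finset_weighted hX hg a (J := Finset.range k \ J) (K := J)
    Finset.sdiff_disjoint
  have h1 := measure_add_near_le (measurable_finset_weighted hX hg a _)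
    (measurable_finset_weighted hX hg a J) hind MeasurableSet.univ hJ 0
  simp only [Set.mem_univ, true_and, sub_zero, Finset.sum_sdiff hsub] at h1
  refine h1.trans ?_
  simpa using hm

end Anticoncentration

end

/-! ### Decisions with ties broken by a coin -/

section

variable {Ω : Type*} [MeasurableSpace Ω] {P : Measure Ω} [IsProbabilityMeasure P]

open Classical in
/-- The sign of `t`, with `l` deciding the tie `t = 0`. -/
noncomputable def tieSign (t l : ℝ) : ℝ := if t = 0 then l else Real.sign t

/-- A tie-breaking coin: it takes the values `±1`, not necessarily with equal probabilities, and is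
independent of the margins. -/
structure IsCoin (P : Measure Ω) (X : ℕ → Ω → ℝ) (L : Ω → ℝ) : Prop where
  meas : Measurable L
  abs_eq_one : ∀ᵐ ω ∂P, |L ω| = 1
  indep : IndepFun L (fun ω i => X i ω) P

theorem measurable_tieSign : Measurable fun p : ℝ × ℝ => tieSign p.1 p.2 :=
  Measurable.ite (measurableSet_eq_fun measurable_fst measurable_const) measurable_snd
    (measurable_sign.comp measurable_fst)

theorem abs_tieSign {t l : ℝ} (hl : |l| = 1) : |tieSign t l| = 1 := by
  unfold tieSign
  split_ifs with h
  · exact hl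
  · rcases lt_or_gt_of_ne h with h | h
    · simp [Real.sign_of_neg h]
    · simp [Real.sign_of_pos h]

variable {X : ℕ → Ω → ℝ} {f g : ℝ → ℝ} {s a : ℕ → ℝ} {L : ℕ → Ω → ℝ}

/-- The decision based on the first `k` groups and the coin `l`. -/
noncomputable def groupDecision (a : ℕ → ℝ) (g : ℝ → ℝ) (X : ℕ → Ω → ℝ) (l : Ω → ℝ) (k : ℕ)
    (ω : Ω) : ℝ :=
  tieSign (weightedSum a g X k ω) (l ω)

omit [IsProbabilityMeasure P] in
theorem measurable_groupDecision (hX : IsMarginSeq P X) (hg : IsRule g) (a : ℕ → ℝ) {l : Ω → ℝ}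
    (hl : Measurable l) (k : ℕ) : Measurable (groupDecision a g X l k) :=
  measurable_tieSign.comp ((measurable_weightedSum hX.meas hg.meas a k).prodMk hl)

omit [IsProbabilityMeasure P] in
theorem IsCoin.abs_groupDecision {l : Ω → ℝ} (hl : IsCoin P X l) (a : ℕ → ℝ) (g : ℝ → ℝ) (k : ℕ) :
    ∀ᵐ ω ∂P, |groupDecision a g X l k ω| = 1 :=
  hl.abs_eq_one.mono fun _ h => abs_tieSign h

/-- The limits of welfare and inversion probability when the weighted sum is asymptotically normal:
ties are then asymptotically negligible. -/
theorem tendsto_of_asymptotically_normal (hX : IsMarginSeq P X) (hf : IsRule f) (hg : IsRule g)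
    (hL : ∀ n, IsCoin P X (L n))
    (hS : Tendsto (weightedSD P s f X) atTop atTop)
    (hA : Tendsto (weightedSD P a g X) atTop atTop) {κ : ℝ} (hκ1 : |κ| ≤ 1)
    (hκ : Tendsto (stdPairLaw hX hf hg s a) atTop (𝓝 (correlatedGaussian κ))) :
    Tendsto (fun n => ∫ ω, groupDecision a g X (L n) n ω *
      (weightedSum s f X n ω / weightedSD P s f X n) ∂P) atTop (𝓝 (√(2 / Real.pi) * κ)) ∧
    Tendsto (fun n => P.real {ω | groupDecision a g X (L n) n ω *
      (weightedSum s f X n ω / weightedSD P s f X n) < 0}) atTop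
      (𝓝 (Real.arccos κ / Real.pi)) := by
  have hne : ∀ n, P.real {ω | groupDecision a g X (L n) n ω ≠ Real.sign (weightedSum a g X n ω)}
      ≤ P.real {ω | |weightedSum a g X n ω| ≤ 0} := fun n => by
    refine measureReal_mono fun ω hω => ?_
    by_contra h
    refine hω ?_
    have h : weightedSum a g X n ω ≠ 0 := fun h0 => h (by simp [h0])
    simp [groupDecision, tieSign, h]
  have h0 := tendsto_prob_abs_le hX hf hg hA hκ 0
  have hp0 : Tendsto (fun n => P.real {ω | groupDecision a g X (L n) n ω ≠
      Real.sign (weightedSum a g X n ω)}) atTop (𝓝 0) :=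
    squeeze_zero (fun _ => measureReal_nonneg) hne h0
  constructor
  · -- with `M = 4 / ε`, the replacement bound `M p + 1 / M` is below `ε` once `p < ε ^ 2 / 8`
    have key := tendsto_integral_mul_sign hX hf hg hS hA hκ
    refine tendsto_of_tendsto_of_dist key ?_
    rw [Metric.tendsto_atTop']
    intro ε hε
    have hM : 0 < 4 / ε := by positivity
    obtain ⟨N, hN⟩ := eventually_atTop.1 ((hp0.eventually (gt_mem_nhds
      (show 0 < ε ^ 2 / 8 by positivity))).and (hS.eventually_gt_atTop 0))
    refine ⟨N, fun n hn => ?_⟩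
    obtain ⟨h1, h2⟩ := hN n hn.le
    have := abs_integral_mul_sub_le (measurable_groupDecision hX hg a (hL n).meas n)
      (measurable_sign.comp (measurable_weightedSum hX.meas hg.meas a n))
      ((hL n).abs_groupDecision a g n |>.mono fun _ h => h.le) (ae_of_all _ fun _ => abs_sign_le_one _)
      (memLp_standardized (s := s) hX hf n) (integral_sq_standardized hX hf h2).le hM
    rw [Real.dist_eq, sub_zero, abs_of_nonneg dist_nonneg, dist_comm, Real.dist_eq]
    refine this.trans_lt ?_
    have e1 : 1 / (4 / ε) = ε / 4 := by field_simp
    rw [e1]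
    have : 4 / ε * P.real {ω | groupDecision a g X (L n) n ω ≠ Real.sign (weightedSum a g X n ω)}
        ≤ 4 / ε * (ε ^ 2 / 8) := by gcongr
    have e2 : 4 / ε * (ε ^ 2 / 8) = ε / 2 := by field_simp; norm_num
    simp only [Function.comp_apply]
    linarith
  · have key := tendsto_prob_mul_neg hX hf hg hA hκ1 hκ
    refine tendsto_of_tendsto_of_dist key ?_
    refine squeeze_zero (fun _ => dist_nonneg) (fun n => ?_) hp0
    rw [dist_comm, Real.dist_eq]
    exact abs_prob_mul_neg_sub_le

section Flip

/-- The law of the coin and the margins is unchanged when the margins with index at least `k`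
change sign. -/
theorem identDistrib_flip (hX : IsMarginSeq P X) {l : Ω → ℝ} (hl : IsCoin P X l) (k : ℕ) :
    IdentDistrib (fun ω => (l ω, fun i => X i ω))
      (fun ω => (l ω, fun i => if i < k then X i ω else -X i ω)) P P := by
  have hm : ∀ i, Measurable fun x : ℝ => if i < k then x else -x := fun i => by
    split_ifs <;> fun_prop
  have hmp : Measurable fun (x : ℕ → ℝ) i => if i < k then x i else -x i :=
    measurable_pi_lambda _ fun i => (hm i).comp (measurable_pi_apply i)
  refine IdentDistrib.prodMk (IdentDistrib.refl hl.meas.aemeasurable)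
    (IdentDistrib.pi (X := X) (Y := fun i ω => if i < k then X i ω else -X i ω) (fun i => ?_)
      hX.indep (hX.indep.comp _ hm)) hl.indep (hl.indep.comp measurable_id hmp)
  by_cases h : i < k
  · simpa [h] using IdentDistrib.refl (hX.meas i).aemeasurable
  · have h1 := (hX.ident i).comp (u := fun x => -x) measurable_neg
    simpa [h, Function.comp_def] using ((h1.trans hX.symm).trans (hX.ident i).symm).symm

/-- The decision of the first `k` groups times the margin of the later ones is symmetric. -/
theorem identDistrib_decision_mul_tail (hX : IsMarginSeq P X) (hf : IsRule f) (hg : IsRule g)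
    {l : Ω → ℝ} (hl : IsCoin P X l) (s a : ℕ → ℝ) (k n : ℕ) :
    IdentDistrib (fun ω => groupDecision a g X l k ω * ∑ i ∈ Finset.Ico k n, s i * f (X i ω))
      (fun ω => -(groupDecision a g X l k ω * ∑ i ∈ Finset.Ico k n, s i * f (X i ω))) P P := by
  have hF : Measurable fun p : ℝ × (ℕ → ℝ) => tieSign (∑ i ∈ Finset.range k, a i * g (p.2 i)) p.1 *
      ∑ i ∈ Finset.Ico k n, s i * f (p.2 i) := by
    have hw : ∀ {r : ℝ → ℝ}, IsRule r → ∀ (w : ℕ → ℝ) (J : Finset ℕ),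
        Measurable fun p : ℝ × (ℕ → ℝ) => ∑ i ∈ J, w i * r (p.2 i) := fun hr w J =>
      Finset.measurable_fun_sum J fun i _ =>
        (hr.meas.comp ((measurable_pi_apply i).comp measurable_snd)).const_mul (w i)
    exact (measurable_tieSign.comp ((hw hg a (Finset.range k)).prodMk measurable_fst)).mul
      (hw hf s (Finset.Ico k n))
  have h := (identDistrib_flip hX hl k).comp hF
  convert! h using 1
  funext ω
  have e1 : ∑ i ∈ Finset.range k, a i * g (if i < k then X i ω else -X i ω)
      = weightedSum a g X k ω :=
    Finset.sum_congr rfl fun i hi => by rw [if_pos (Finset.mem_range.1 hi)]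
  have e2 : ∑ i ∈ Finset.Ico k n, s i * f (if i < k then X i ω else -X i ω)
      = -∑ i ∈ Finset.Ico k n, s i * f (X i ω) := by
    rw [← Finset.sum_neg_distrib]
    refine Finset.sum_congr rfl fun i hi => ?_
    rw [if_neg (not_lt.2 (Finset.mem_Ico.1 hi).1), hf.odd, mul_neg]
  simp only [Function.comp_apply, e1, e2, groupDecision, mul_neg]

omit [MeasurableSpace Ω] in
theorem weightedSum_eq_add (s : ℕ → ℝ) (f : ℝ → ℝ) (X : ℕ → Ω → ℝ) {k n : ℕ} (h : k ≤ n) (ω : Ω) :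
    weightedSum s f X n ω = weightedSum s f X k ω + ∑ i ∈ Finset.Ico k n, s i * f (X i ω) :=
  (Finset.sum_range_add_sum_Ico _ h).symm

omit [MeasurableSpace Ω] in
theorem abs_weightedSum_le (hf : IsRule f) {b : ℝ} (hs : ∀ i, |s i| ≤ b) (k : ℕ) (ω : Ω) :
    |weightedSum s f X k ω| ≤ k * b := by
  refine (Finset.abs_sum_le_sum_abs _ _).trans ((Finset.sum_le_sum fun i _ => ?_).trans
    (by simp : ∑ _i ∈ Finset.range k, b ≤ k * b))
  rw [abs_mul]
  exact (mul_le_of_le_one_right (abs_nonneg _) (hf.bound _)).trans (hs i)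

/-- A decision by the first `k` groups earns no expected welfare from the later groups, hence a
bounded amount in all. -/
theorem abs_integral_groupDecision_mul_le (hX : IsMarginSeq P X) (hf : IsRule f) (hg : IsRule g)
    {l : Ω → ℝ} (hl : IsCoin P X l) {b : ℝ} (hs : ∀ i, |s i| ≤ b) (a : ℕ → ℝ) {k n : ℕ}
    (h : k ≤ n) : |∫ ω, groupDecision a g X l k ω * weightedSum s f X n ω ∂P| ≤ k * b := by
  have hD := measurable_groupDecision hX hg a hl.meas k
  have hD1 := (hl.abs_groupDecision a g k).mono fun _ h => h.le
  have h0 : ∫ ω, groupDecision a g X l k ω * ∑ i ∈ Finset.Ico k n, s i * f (X i ω) ∂P = 0 := by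
    have := (identDistrib_decision_mul_tail hX hf hg hl s a k n).integral_eq
    rw [integral_neg] at this
    linarith
  have i1 : Integrable (fun ω => groupDecision a g X l k ω * weightedSum s f X k ω) P :=
    ((hX.memLp_weighted hf s _).integrable (by norm_num)).bdd_mul hD.aestronglyMeasurable hD1
  have i2 : Integrable (fun ω => groupDecision a g X l k ω *
      ∑ i ∈ Finset.Ico k n, s i * f (X i ω)) P :=
    ((hX.memLp_weighted hf s _).integrable (by norm_num)).bdd_mul hD.aestronglyMeasurable hD1
  simp_rw [weightedSum_eq_add s f X h, mul_add]
  rw [integral_add i1 i2, h0, add_zero, ← Real.norm_eq_abs]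
  refine (norm_integral_le_of_norm_le_const (C := k * b) ?_).trans (by simp)
  filter_upwards [hD1] with ω hω
  rw [norm_mul]
  exact (mul_le_of_le_one_left (norm_nonneg _) hω).trans (abs_weightedSum_le hf hs k ω)

/-- A decision by the first `k` groups disagrees with the majority with probability one half, up to
the probability that the total margin is comparable to that of the first `k` groups. -/
theorem abs_prob_groupDecision_mul_neg_sub_half_le (hX : IsMarginSeq P X) (hf : IsRule f)
    (hg : IsRule g) {l : Ω → ℝ} (hl : IsCoin P X l) {b : ℝ} (hs : ∀ i, |s i| ≤ b) (a : ℕ → ℝ)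
    {k n : ℕ} (h : k ≤ n) :
    |P.real {ω | groupDecision a g X l k ω * weightedSum s f X n ω < 0} - 1 / 2|
      ≤ 2 * P.real {ω | |weightedSum s f X n ω| ≤ k * b} := by
  set F : Ω → ℝ := fun ω => groupDecision a g X l k ω * ∑ i ∈ Finset.Ico k n, s i * f (X i ω)
    with hF
  have hFm : Measurable F := (measurable_groupDecision hX hg a hl.meas k).mul
    (measurable_finset_weighted hX hf s _)
  set C := {ω | |weightedSum s f X n ω| ≤ k * b} with hC
  have hsplit : ∀ ω, ∃ y, |y| ≤ k * b ∧
      weightedSum s f X n ω = y + ∑ i ∈ Finset.Ico k n, s i * f (X i ω) := fun ω =>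
    ⟨_, abs_weightedSum_le hf hs k ω, weightedSum_eq_add s f X h ω⟩
  -- outside `C` the first `k` groups do not change the sign of the total margin
  have h1 : |P.real {ω | groupDecision a g X l k ω * weightedSum s f X n ω < 0}
      - P.real {ω | F ω < 0}| ≤ P.real C := by
    refine abs_measureReal_sub_le (fun ω hω => ?_) fun ω hω => ?_
    · by_cases hc : F ω < 0
      · exact Or.inl hc
      · right
        obtain ⟨y, hy, hyS⟩ := hsplit ω
        rw [abs_le] at hy
        simp only [Set.mem_ofPred_eq, hC, hF, not_lt] at hω hc ⊢
        rw [abs_le]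
        rcases mul_neg_iff.1 hω with ⟨hd, hn⟩ | ⟨hd, hn⟩
        · have := nonneg_of_mul_nonneg_right hc hd
          constructor <;> linarith
        · have : ∑ i ∈ Finset.Ico k n, s i * f (X i ω) ≤ 0 := by
            by_contra! h; linarith [mul_neg_of_neg_of_pos hd h]
          constructor <;> linarith
    · by_cases hc : groupDecision a g X l k ω * weightedSum s f X n ω < 0
      · exact Or.inl hc
      · right
        obtain ⟨y, hy, hyS⟩ := hsplit ω
        rw [abs_le] at hy
        simp only [Set.mem_ofPred_eq, hC, hF, not_lt] at hω hc ⊢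
        rw [abs_le]
        rcases mul_neg_iff.1 hω with ⟨hd, hn⟩ | ⟨hd, hn⟩
        · have := nonneg_of_mul_nonneg_right hc hd
          constructor <;> linarith
        · have : weightedSum s f X n ω ≤ 0 := by
            by_contra! h; linarith [mul_neg_of_neg_of_pos hd h]
          constructor <;> linarith
  -- `F` is symmetric, and vanishes only when the margin of the later groups does
  have h2 : P.real {ω | F ω < 0} = P.real {ω | 0 < F ω} := by
    have := (identDistrib_decision_mul_tail hX hf hg hl s a k n).measure_mem_eq
      (s := Set.Iio 0) measurableSet_Iio
    rw [measureReal_def, measureReal_def]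
    congr 1
    refine Eq.trans this ?_
    congr 1
    ext ω
    simp [hF]
  have h3 : P.real {ω | F ω < 0} + P.real {ω | 0 < F ω} + P.real {ω | F ω = 0} = 1 := by
    have m1 : MeasurableSet {ω | F ω < 0} := measurableSet_lt hFm measurable_const
    have m2 : MeasurableSet {ω | 0 < F ω} := measurableSet_lt measurable_const hFm
    have m3 : MeasurableSet {ω | F ω = 0} := measurableSet_eq_fun hFm measurable_const
    rw [← measureReal_union _ m2, ← measureReal_union _ m3]
    · have : ({ω | F ω < 0} ∪ {ω | 0 < F ω}) ∪ {ω | F ω = 0} = Set.univ := by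
        ext ω
        rcases lt_trichotomy (F ω) 0 with h | h | h <;> simp [h]
      rw [this]; simp
    · rw [Set.disjoint_left]
      rintro ω (h | h) h'
      · exact (ne_of_lt h) h'
      · exact (ne_of_gt h) h'
    · rw [Set.disjoint_left]
      intro ω h h'
      exact lt_asymm (show F ω < 0 from h) h'
  have h4 : P.real {ω | F ω = 0} ≤ P.real C := by
    refine ENNReal.toReal_mono (measure_ne_top _ _) (measure_mono_ae ?_)
    filter_upwards [hl.abs_groupDecision a g k] with ω hω hF0
    obtain ⟨y, hy, hyS⟩ := hsplit ω
    have hd : groupDecision a g X l k ω ≠ 0 := by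
      intro h0; rw [h0] at hω; norm_num at hω
    have : ∑ i ∈ Finset.Ico k n, s i * f (X i ω) = 0 := (mul_eq_zero.1 hF0).resolve_left hd
    change |weightedSum s f X n ω| ≤ k * b
    rwa [hyS, this, add_zero]
  have h5 : 0 ≤ P.real {ω | F ω = 0} := measureReal_nonneg
  rw [abs_le] at h1 ⊢
  constructor <;> linarith [h1.1, h1.2]

end Flip

/-- If the decision is, up to small probability, that of finitely many groups and the coin, then
welfare vanishes asymptotically and the majority is overruled half of the time. -/
theorem tendsto_of_finitely_determined (hX : IsMarginSeq P X) (hf : IsRule f) (hg : IsRule g)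
    (hL : ∀ n, IsCoin P X (L n)) {b : ℝ} (hs : ∀ i, |s i| ≤ b)
    (hS : Tendsto (weightedSD P s f X) atTop atTop)
    (hcl : ∀ K, Tendsto (fun n => P.real {ω | |weightedSum s f X n ω| ≤ K}) atTop (𝓝 0))
    (happ : ∀ ε > 0, ∃ k, ∀ᶠ n in atTop,
      P.real {ω | groupDecision a g X (L n) n ω ≠ groupDecision a g X (L n) k ω} ≤ ε) :
    Tendsto (fun n => ∫ ω, groupDecision a g X (L n) n ω *
      (weightedSum s f X n ω / weightedSD P s f X n) ∂P) atTop (𝓝 0) ∧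
    Tendsto (fun n => P.real {ω | groupDecision a g X (L n) n ω *
      (weightedSum s f X n ω / weightedSD P s f X n) < 0}) atTop (𝓝 (1 / 2)) := by
  constructor
  · rw [Metric.tendsto_atTop']
    intro ε hε
    have hM : 0 < 4 / ε := by positivity
    obtain ⟨k, hk⟩ := happ (ε ^ 2 / 16) (by positivity)
    obtain ⟨N, hN⟩ := eventually_atTop.1 (hk.and ((hS.eventually_gt_atTop 0).and
      (((hS.const_div_atTop (k * b)).eventually (gt_mem_nhds (show 0 < ε / 4 by positivity))).and
        (eventually_ge_atTop k))))
    refine ⟨N, fun n hn => ?_⟩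
    obtain ⟨h1, h2, h3, h4⟩ := hN n hn.le
    have k1 := abs_integral_mul_sub_le (measurable_groupDecision hX hg a (hL n).meas n)
      (measurable_groupDecision hX hg a (hL n).meas k)
      ((hL n).abs_groupDecision a g n |>.mono fun _ h => h.le)
      ((hL n).abs_groupDecision a g k |>.mono fun _ h => h.le)
      (memLp_standardized (s := s) hX hf n) (integral_sq_standardized hX hf h2).le hM
    have k2 : |∫ ω, groupDecision a g X (L n) k ω *
        (weightedSum s f X n ω / weightedSD P s f X n) ∂P| < ε / 4 := by
      simp_rw [← mul_div_assoc]
      rw [integral_div, abs_div, abs_of_pos h2]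
      refine lt_of_le_of_lt ?_ h3
      gcongr
      exact abs_integral_groupDecision_mul_le hX hf hg (hL n) hs a h4
    have e1 : 1 / (4 / ε) = ε / 4 := by field_simp
    have e2 : 4 / ε * (ε ^ 2 / 16) = ε / 4 := by field_simp; norm_num
    have e3 : 4 / ε * P.real {ω | groupDecision a g X (L n) n ω ≠ groupDecision a g X (L n) k ω}
        ≤ 4 / ε * (ε ^ 2 / 16) := by gcongr
    rw [Real.dist_eq, sub_zero]
    rw [abs_le] at k1
    rw [abs_lt] at k2 ⊢
    constructor <;> linarith [k1.1, k1.2, k2.1, k2.2]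
  · rw [Metric.tendsto_atTop']
    intro ε hε
    obtain ⟨k, hk⟩ := happ (ε / 4) (by positivity)
    obtain ⟨N, hN⟩ := eventually_atTop.1 (hk.and ((hS.eventually_gt_atTop 0).and
      (((hcl (k * b)).eventually (gt_mem_nhds (show 0 < ε / 8 by positivity))).and
        (eventually_ge_atTop k))))
    refine ⟨N, fun n hn => ?_⟩
    obtain ⟨h1, h2, h3, h4⟩ := hN n hn.le
    have k1 := abs_prob_mul_neg_sub_le (P := P) (D := groupDecision a g X (L n) n)
      (D' := groupDecision a g X (L n) k) (U := weightedSum s f X n)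
    have k2 := abs_prob_groupDecision_mul_neg_sub_half_le hX hf hg (hL n) hs a h4
    have e : {ω | groupDecision a g X (L n) n ω *
        (weightedSum s f X n ω / weightedSD P s f X n) < 0}
        = {ω | groupDecision a g X (L n) n ω * weightedSum s f X n ω < 0} := by
      ext ω
      simp only [Set.mem_ofPred_eq]
      rw [← mul_div_assoc, div_lt_iff₀ h2, zero_mul]
    rw [Real.dist_eq, e]
    rw [abs_le] at k1 k2
    rw [abs_lt]
    constructor <;> linarith [k1.1, k1.2, k2.1, k2.2]

end

/-! ### The limits in all cases -/

section

variable {Ω : Type*} [MeasurableSpace Ω] {P : Measure Ω} [IsProbabilityMeasure P]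

variable {X : ℕ → Ω → ℝ} {f g : ℝ → ℝ} {s a : ℕ → ℝ} {L : ℕ → Ω → ℝ}

/-- A perturbation smaller than the margin does not change the decision. -/
theorem tieSign_congr {x y l : ℝ} (h : |y - x| < |x|) : tieSign y l = tieSign x l := by
  have hx : x ≠ 0 := by rintro rfl; simp at h; linarith [abs_nonneg y]
  unfold tieSign
  rcases lt_or_gt_of_ne hx with h0 | h0
  · rw [abs_of_neg h0, abs_lt] at h
    have : y < 0 := by linarith
    rw [if_neg this.ne, if_neg hx, Real.sign_of_neg this, Real.sign_of_neg h0]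
  · rw [abs_of_pos h0, abs_lt] at h
    have : 0 < y := by linarith
    rw [if_neg this.ne', if_neg hx, Real.sign_of_pos this, Real.sign_of_pos h0]

/-- If the squared weights are summable, infinitely many of them positive, then the sign of the
weighted sum is determined by finitely many groups up to small probability. -/
theorem exists_decision_approx_of_summable (hX : IsMarginSeq P X) (hg : IsRule g)
    (hg0 : 0 < crossMoment P X g g) (L : ℕ → Ω → ℝ) (ha0 : ∀ i, 0 ≤ a i)
    (hsum : Summable fun i => a i ^ 2) (hinf : ∀ N, ∃ i ≥ N, a i ≠ 0) {ε : ℝ} (hε : 0 < ε) :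
    ∃ k, ∀ᶠ n in atTop,
      P.real {ω | groupDecision a g X (L n) n ω ≠ groupDecision a g X (L n) k ω} ≤ ε := by
  have hat : Tendsto a atTop (𝓝 0) := by
    have h := (Real.continuous_sqrt.tendsto _).comp hsum.tendsto_atTop_zero
    simpa [Function.comp_def, Real.sqrt_sq (ha0 _)] using h
  obtain ⟨δ, hδ, k₀, hk₀⟩ := exists_anticoncentration hX hg hg0 ha0 hat hinf
    (ε := ENNReal.ofReal (ε / 2)) (by simpa using hε)
  set q := crossMoment P X g g with hq
  have hη : 0 < ε / 2 * δ ^ 2 / q := by positivity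
  obtain ⟨N, hN⟩ := summable_iff_vanishing_norm.1 hsum _ hη
  refine ⟨max k₀ (N.sup id + 1), eventually_atTop.2 ⟨max k₀ (N.sup id + 1), fun n hn => ?_⟩⟩
  set k := max k₀ (N.sup id + 1) with hk
  have hdisj : Disjoint (Finset.Ico k n) N := by
    rw [Finset.disjoint_left]
    intro i hi hiN
    have h1 : i ≤ N.sup id := Finset.le_sup (f := id) hiN
    have h2 := (Finset.mem_Ico.1 hi).1
    have h3 : N.sup id + 1 ≤ k := le_max_right _ _
    omega
  have htail : q * ∑ i ∈ Finset.Ico k n, a i ^ 2 ≤ ε / 2 * δ ^ 2 := by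
    have := (le_abs_self _).trans (hN _ hdisj).le
    rw [le_div_iff₀ hg0] at this
    linarith
  -- the decisions differ only if the first `k` groups are nearly tied or the rest is not small
  have h1 : P.real {ω | |weightedSum a g X k ω| ≤ δ} ≤ ε / 2 :=
    ENNReal.toReal_le_of_le_ofReal (by positivity) (hk₀ k (le_max_left _ _))
  have h2 : P.real {ω | δ ^ 2 ≤ (∑ i ∈ Finset.Ico k n, a i * g (X i ω)) ^ 2} ≤ ε / 2 := by
    have hm := mul_meas_ge_le_integral_of_nonneg (μ := P)
      (f := fun ω => (∑ i ∈ Finset.Ico k n, a i * g (X i ω)) ^ 2)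
      (ae_of_all _ fun _ => sq_nonneg _) (hX.memLp_weighted hg a _).integrable_sq (δ ^ 2)
    rw [hX.integral_sq_weighted hg] at hm
    exact le_of_mul_le_mul_left (by linarith) (show 0 < δ ^ 2 by positivity)
  refine (measureReal_mono (fun ω hω => ?_)).trans
    ((measureReal_union_le {ω | |weightedSum a g X k ω| ≤ δ}
      {ω | δ ^ 2 ≤ (∑ i ∈ Finset.Ico k n, a i * g (X i ω)) ^ 2}).trans (by linarith))
  by_contra hcon
  simp only [Set.mem_union, Set.mem_ofPred_eq, not_or, not_le] at hcon
  refine hω (tieSign_congr ?_)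
  rw [weightedSum_eq_add a g X hn ω, add_sub_cancel_left]
  exact (abs_lt_of_sq_lt_sq hcon.2 hδ.le).trans hcon.1

omit [IsProbabilityMeasure P] in
/-- If the weighted sum is almost surely constant in the number of groups from `k` on, the decision is
determined by the first `k` groups. -/
theorem groupDecision_approx_of_ae_eq {k : ℕ} (L : ℕ → Ω → ℝ)
    (h : ∀ n ≥ k, ∀ᵐ ω ∂P, weightedSum a g X n ω = weightedSum a g X k ω) {ε : ℝ} (hε : 0 < ε) :
    ∃ k, ∀ᶠ n in atTop,
      P.real {ω | groupDecision a g X (L n) n ω ≠ groupDecision a g X (L n) k ω} ≤ ε := by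
  refine ⟨k, eventually_atTop.2 ⟨k, fun n hn => ?_⟩⟩
  have : P {ω | groupDecision a g X (L n) n ω ≠ groupDecision a g X (L n) k ω} = 0 := by
    refine ae_iff.1 ?_
    filter_upwards [h n hn] with ω hω
    simp [groupDecision, hω]
  rw [measureReal_def, this]
  simpa using hε.le

/-- A square-summable weight sequence is asymptotically orthogonal to one of infinite norm. -/
theorem tendsto_inner_div_norm_of_summable
    (hs : Tendsto (fun n => ∑ i ∈ Finset.range n, s i ^ 2) atTop atTop)
    (hsum : Summable fun i => a i ^ 2) :
    Tendsto (fun n => (∑ i ∈ Finset.range n, s i * a i) / √(∑ i ∈ Finset.range n, s i ^ 2)) atTop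
      (𝓝 0) := by
  have hS : Tendsto (fun n => √(∑ i ∈ Finset.range n, s i ^ 2)) atTop atTop :=
    Real.tendsto_sqrt_atTop.comp hs
  rw [Metric.tendsto_atTop']
  intro ε hε
  obtain ⟨N, hN⟩ := summable_iff_vanishing_norm.1 hsum ((ε / 2) ^ 2) (by positivity)
  set k := N.sup id + 1 with hk
  set K := |∑ i ∈ Finset.range k, s i * a i|
  obtain ⟨M, hM⟩ := eventually_atTop.1 ((hS.eventually_gt_atTop 0).and
    (((hS.const_div_atTop K).eventually (gt_mem_nhds (show 0 < ε / 2 by positivity))).and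
      (eventually_ge_atTop k)))
  refine ⟨M, fun n hn => ?_⟩
  obtain ⟨h1, h2, h3⟩ := hM n hn.le
  have hdisj : Disjoint (Finset.Ico k n) N := by
    rw [Finset.disjoint_left]
    intro i hi hiN
    have h1 : i ≤ N.sup id := Finset.le_sup (f := id) hiN
    have h2 := (Finset.mem_Ico.1 hi).1
    omega
  have htail : √(∑ i ∈ Finset.Ico k n, a i ^ 2) ≤ ε / 2 := by
    rw [Real.sqrt_le_left (by positivity)]
    exact (le_abs_self _).trans (hN _ hdisj).le
  have hCS : |∑ i ∈ Finset.Ico k n, s i * a i| ≤ √(∑ i ∈ Finset.range n, s i ^ 2) * (ε / 2) := by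
    refine (Finset.abs_sum_le_sum_abs _ _).trans ?_
    simp_rw [abs_mul]
    refine (Real.sum_mul_le_sqrt_mul_sqrt _ _ _).trans ?_
    simp_rw [sq_abs]
    refine mul_le_mul (Real.sqrt_le_sqrt ?_) htail (Real.sqrt_nonneg _) (Real.sqrt_nonneg _)
    exact Finset.sum_le_sum_of_subset_of_nonneg
      (fun i hi => Finset.mem_range.2 (Finset.mem_Ico.1 hi).2) fun _ _ _ => sq_nonneg _
  rw [Real.dist_eq, sub_zero, abs_div, abs_of_pos h1, div_lt_iff₀ h1,
    ← Finset.sum_range_add_sum_Ico _ h3]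
  rw [div_lt_iff₀ h1] at h2
  refine (abs_add_le _ _).trans_lt ?_
  linarith

omit [IsProbabilityMeasure P] in
/-- If the weights are square-summable while the sizes are not, the correlation vanishes in the
limit. -/
theorem tendsto_pairCorr_of_summable
    (hs : Tendsto (fun n => ∑ i ∈ Finset.range n, s i ^ 2) atTop atTop)
    (hsum : Summable fun i => a i ^ 2) (hg0 : 0 < crossMoment P X g g) :
    Tendsto (pairCorr P s a f g X) atTop (𝓝 0) := by
  by_cases hz : ∀ i, a i = 0
  · have : pairCorr P s a f g X = fun _ => 0 := by
      funext n; simp [pairCorr, hz]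
    rw [this]; exact tendsto_const_nhds
  · push Not at hz
    obtain ⟨j, hj⟩ := hz
    have hlow : ∀ n ≥ j + 1, √(crossMoment P X g g * a j ^ 2) ≤ weightedSD P a g X n := by
      intro n hn
      refine Real.sqrt_le_sqrt (mul_le_mul_of_nonneg_left ?_ hg0.le)
      exact Finset.single_le_sum (f := fun i => a i ^ 2) (fun _ _ => sq_nonneg _)
        (Finset.mem_range.2 hn)
    have hpos : 0 < √(crossMoment P X g g * a j ^ 2) := Real.sqrt_pos.2 (by positivity)
    set C := |crossMoment P X f g| / √(crossMoment P X f f) / √(crossMoment P X g g * a j ^ 2)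
    have h0 := ((tendsto_inner_div_norm_of_summable hs hsum).abs.const_mul C)
    rw [abs_zero, mul_zero] at h0
    refine squeeze_zero_norm' ?_ h0
    filter_upwards [eventually_ge_atTop (j + 1)] with n hn
    have hff : 0 ≤ crossMoment P X f f := integral_nonneg fun _ => mul_self_nonneg _
    have hl := hlow n hn
    rw [Real.norm_eq_abs, pairCorr, abs_div, abs_mul, abs_mul,
      abs_of_nonneg (hpos.le.trans hl), weightedSD, abs_of_nonneg (Real.sqrt_nonneg _), Real.sqrt_mul hff, abs_div,
      abs_of_nonneg (Real.sqrt_nonneg (∑ i ∈ Finset.range n, s i ^ 2))]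
    have e : ∀ x y p q r : ℝ, x * y / (p * q * r) = x / p * (y / q) * r⁻¹ := fun x y p q r => by
      simp only [div_eq_mul_inv, mul_inv]; ring
    rw [e, div_mul_eq_mul_div _ √(crossMoment P X g g * a j ^ 2), div_eq_mul_inv _
      √(crossMoment P X g g * a j ^ 2)]
    exact mul_le_mul_of_nonneg_left (inv_anti₀ hpos hl) (by positivity)

omit [IsProbabilityMeasure P] in
theorem pairCorr_self {n : ℕ} (hn : 0 < weightedSD P s f X n) : pairCorr P s s f f X n = 1 := by
  rw [pairCorr, ← sq, weightedSD_sq]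
  simp_rw [← sq]
  refine div_self ?_
  rw [← weightedSD_sq]; positivity

theorem tendsto_stdPairLaw_self (hX : IsMarginSeq P X) (hf : IsRule f)
    (hf0 : 0 < crossMoment P X f f) {bs : ℝ} (hsb : ∀ i, |s i| ≤ bs)
    (hs : Tendsto (fun n => ∑ i ∈ Finset.range n, s i ^ 2) atTop atTop) :
    Tendsto (stdPairLaw hX hf hf s s) atTop (𝓝 (correlatedGaussian 1)) := by
  refine (tendsto_stdPairLaw hX hf hf hf0 hf0 hsb hsb hs hs ?_).2
  refine tendsto_const_nhds.congr' ?_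
  filter_upwards [(tendsto_weightedSD hf0 hs).eventually_gt_atTop 0] with n hn
  exact (pairCorr_self hn).symm

/-- The mean absolute vote margin: the expected welfare of the allocation proportional to size under
the proportional rule, whose correlation is one. -/
theorem tendsto_integral_abs (hX : IsMarginSeq P X) (hf : IsRule f)
    (hf0 : 0 < crossMoment P X f f) {bs : ℝ} (hsb : ∀ i, |s i| ≤ bs)
    (hs : Tendsto (fun n => ∑ i ∈ Finset.range n, s i ^ 2) atTop atTop) :
    Tendsto (fun n => ∫ ω, |weightedSum s f X n ω| / weightedSD P s f X n ∂P) atTop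
      (𝓝 (√(2 / Real.pi))) := by
  have hS := tendsto_weightedSD (P := P) hf0 hs
  have h := tendsto_integral_mul_sign hX hf hf hS hS (tendsto_stdPairLaw_self hX hf hf0 hsb hs)
  rw [mul_one] at h
  refine h.congr fun n => integral_congr_ae (ae_of_all _ fun ω => ?_)
  simp only
  rw [← mul_div_assoc, mul_comm, mul_sign_self]

/-- The limits of expected welfare and of the inversion probability, in all cases. -/
theorem tendsto_welfare_and_inversion (hX : IsMarginSeq P X) (hf : IsRule f) (hg : IsRule g)
    (hL : ∀ n, IsCoin P X (L n)) (hf0 : 0 < crossMoment P X f f) {bs ba : ℝ}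
    (hsb : ∀ i, |s i| ≤ bs) (hab : ∀ i, |a i| ≤ ba) (ha0 : ∀ i, 0 ≤ a i)
    (hs : Tendsto (fun n => ∑ i ∈ Finset.range n, s i ^ 2) atTop atTop) {κ : ℝ}
    (hκ : Tendsto (pairCorr P s a f g X) atTop (𝓝 κ)) :
    Tendsto (fun n => ∫ ω, groupDecision a g X (L n) n ω *
      (weightedSum s f X n ω / weightedSD P s f X n) ∂P) atTop (𝓝 (√(2 / Real.pi) * κ)) ∧
    Tendsto (fun n => P.real {ω | groupDecision a g X (L n) n ω *
      (weightedSum s f X n ω / weightedSD P s f X n) < 0}) atTop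
      (𝓝 (Real.arccos κ / Real.pi)) := by
  have hS := tendsto_weightedSD (P := P) hf0 hs
  have hdet : κ = 0 → (∀ ε > 0, ∃ k, ∀ᶠ n in atTop,
      P.real {ω | groupDecision a g X (L n) n ω ≠ groupDecision a g X (L n) k ω} ≤ ε) → _ :=
    fun _ happ => tendsto_of_finitely_determined hX hf hg hL hsb hS
      (tendsto_prob_abs_le hX hf hf hS (tendsto_stdPairLaw_self hX hf hf0 hsb hs)) happ
  have hhalf : Real.arccos 0 / Real.pi = 1 / 2 := by
    rw [Real.arccos_zero]; field_simp
  rcases (show 0 ≤ crossMoment P X g g from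
    integral_nonneg fun _ => mul_self_nonneg _).eq_or_lt with hg0 | hg0
  · -- the rule vanishes almost surely, and every decision is made by the coin
    have hκ0 : κ = 0 := by
      refine tendsto_nhds_unique hκ (tendsto_const_nhds.congr fun n => ?_)
      simp [pairCorr, weightedSD, ← hg0]
    have hae0 : ∀ᵐ ω ∂P, g (X 0 ω) = 0 := by
      have := (integral_eq_zero_iff_of_nonneg (fun _ => mul_self_nonneg _)
        (hX.integrable_mul hg hg 0)).1 hg0.symm
      filter_upwards [this] with ω hω using mul_self_eq_zero.1 hω
    have hae : ∀ᵐ ω ∂P, ∀ i, g (X i ω) = 0 := ae_all_iff.2 fun i =>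
      (hX.ident i).symm.ae_snd (p := fun x => g x = 0) (measurableSet_eq_fun hg.meas measurable_const)
        hae0
    subst hκ0
    rw [mul_zero, hhalf]
    refine hdet rfl fun ε hε => groupDecision_approx_of_ae_eq (k := 0) L (fun n _ => ?_) hε
    filter_upwards [hae] with ω hω
    simp [weightedSum, hω]
  · by_cases hsum : Summable fun i => a i ^ 2
    · -- the weights are square-summable, so early groups matter for ever
      have hκ0 : κ = 0 := tendsto_nhds_unique hκ (tendsto_pairCorr_of_summable hs hsum hg0)
      subst hκ0
      rw [mul_zero, hhalf]
      refine hdet rfl fun ε hε => ?_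
      by_cases hinf : ∀ N, ∃ i ≥ N, a i ≠ 0
      · exact exists_decision_approx_of_summable hX hg hg0 L ha0 hsum hinf hε
      · push Not at hinf
        obtain ⟨N, hN⟩ := hinf
        refine groupDecision_approx_of_ae_eq (k := N) L (fun n hn => ae_of_all _ fun ω => ?_) hε
        rw [weightedSum_eq_add a g X hn ω, Finset.sum_eq_zero fun i hi => ?_, add_zero]
        rw [hN i (Finset.mem_Ico.1 hi).1, zero_mul]
    · -- both variances diverge, and the central limit theorem applies
      have ha : Tendsto (fun n => ∑ i ∈ Finset.range n, a i ^ 2) atTop atTop :=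
        (not_summable_iff_tendsto_nat_atTop_of_nonneg fun _ => sq_nonneg _).1 hsum
      obtain ⟨hκ1, hlaw⟩ := tendsto_stdPairLaw hX hf hg hf0 hg0 hsb hab hs ha hκ
      exact tendsto_of_asymptotically_normal hX hf hg hL hS (tendsto_weightedSD hg0 ha) hκ1 hlaw

/-- The limit of the mean majority deficit follows from that of expected welfare. -/
theorem tendsto_deficit (hX : IsMarginSeq P X) (hf : IsRule f) (hg : IsRule g)
    (hL : ∀ n, IsCoin P X (L n)) (hf0 : 0 < crossMoment P X f f) {bs : ℝ} (hsb : ∀ i, |s i| ≤ bs)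
    (hs : Tendsto (fun n => ∑ i ∈ Finset.range n, s i ^ 2) atTop atTop) {κ : ℝ}
    (hu : Tendsto (fun n => ∫ ω, groupDecision a g X (L n) n ω *
      (weightedSum s f X n ω / weightedSD P s f X n) ∂P) atTop (𝓝 (√(2 / Real.pi) * κ))) :
    Tendsto (fun n => (1 / 2) * ∫ ω, (|weightedSum s f X n ω| / weightedSD P s f X n
      - groupDecision a g X (L n) n ω * (weightedSum s f X n ω / weightedSD P s f X n)) ∂P) atTop
      (𝓝 ((1 - κ) / √(2 * Real.pi))) := by
  have h := ((tendsto_integral_abs hX hf hf0 hsb hs).sub hu).const_mul (1 / 2)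
  have e : 1 / 2 * (√(2 / Real.pi) - √(2 / Real.pi) * κ) = (1 - κ) / √(2 * Real.pi) := by
    have hπ := Real.pi_pos
    rw [Real.sqrt_div (by norm_num), Real.sqrt_mul (by norm_num)]
    have h2 : √2 * √2 = 2 := Real.mul_self_sqrt (by norm_num)
    field_simp
    linear_combination (1 - κ) * h2
  rw [e] at h
  refine h.congr fun n => ?_
  have hi := (memLp_standardized (P := P) (s := s) hX hf n).integrable (by norm_num)
  rw [integral_sub]
  · have : (fun ω => |weightedSum s f X n ω| / weightedSD P s f X n)
        = fun ω => |weightedSum s f X n ω / weightedSD P s f X n| := by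
      funext ω
      rw [abs_div, abs_of_nonneg (show 0 ≤ weightedSD P s f X n from Real.sqrt_nonneg _)]
    rw [this]; exact hi.abs
  · exact hi.bdd_mul (measurable_groupDecision hX hg a (hL n).meas n).aestronglyMeasurable
      ((hL n).abs_groupDecision a g n |>.mono fun _ h => h.le)

end

/-! ### Empirical averages of group sizes -/

section

section SizeDistribution

variable {sbar : ℝ} {s : ℕ → Set.Icc (0 : ℝ) sbar} {Ψ : ProbabilityMeasure (Set.Icc (0 : ℝ) sbar)}

theorem integral_sizeDist (s : ℕ → Set.Icc (0 : ℝ) sbar) (φ : Set.Icc (0 : ℝ) sbar → ℝ) (n : ℕ) :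
    ∫ t, φ t ∂(sizeDist s n : Measure (Set.Icc (0 : ℝ) sbar))
      = (∑ i ∈ Finset.range (n + 1), φ (s i)) / ((n + 1 : ℕ) : ℝ) := by
  change ∫ t, φ t ∂(sizeMeasure s n) = _
  rw [sizeMeasure, integral_smul_measure, integral_finsetSum_measure fun i _ => by
    exact integrable_dirac (by finiteness)]
  have h : (((n : ENNReal) + 1).toReal) = (n : ℝ) + 1 := by
    rw [ENNReal.toReal_add (by finiteness) (by finiteness)]; simp
  simp [div_eq_inv_mul, h]

/-- Averages over the groups of a bounded function of size that is almost everywhere continuous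
converge to the integral against the limiting size distribution. -/
theorem tendsto_average (hΨ : Tendsto (sizeDist s) atTop (𝓝 Ψ)) {φ : Set.Icc (0 : ℝ) sbar → ℝ}
    (hm : Measurable φ) (hc : ∀ᵐ t ∂(Ψ : Measure (Set.Icc (0 : ℝ) sbar)), ContinuousAt φ t) {C : ℝ}
    (hb : ∀ t, |φ t| ≤ C) :
    Tendsto (fun n : ℕ => (∑ i ∈ Finset.range (n + 1), φ (s i)) / ((n + 1 : ℕ) : ℝ)) atTop
      (𝓝 (∫ t, φ t ∂(Ψ : Measure (Set.Icc (0 : ℝ) sbar)))) := by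
  simp_rw [← integral_sizeDist]
  have hsq : ∀ t, φ t ^ 2 ≤ C ^ 2 := fun t => by
    rw [← sq_abs]; exact pow_le_pow_left₀ (abs_nonneg _) (hb t) 2
  have hi : ∀ μ : ProbabilityMeasure (Set.Icc (0 : ℝ) sbar),
      Integrable (fun t => φ t ^ 2) (μ : Measure (Set.Icc (0 : ℝ) sbar)) := fun μ =>
    Integrable.of_bound (hm.pow_const 2).aestronglyMeasurable (C ^ 2) (ae_of_all _ fun t => by
      rw [Real.norm_of_nonneg (sq_nonneg _)]; exact hsq t)
  have hI : ∀ μ : ProbabilityMeasure (Set.Icc (0 : ℝ) sbar),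
      ∫ t, φ t ^ 2 ∂(μ : Measure (Set.Icc (0 : ℝ) sbar)) ≤ C ^ 2 := fun μ => by
    simpa using integral_mono (hi μ) (integrable_const (C ^ 2)) hsq
  exact tendsto_integral_of_ae_continuousAt hΨ hm hc (hi Ψ) (hI Ψ)
    (Eventually.of_forall fun n => hi _) (Eventually.of_forall fun n => hI _)

theorem integral_sq_pos {φ : Set.Icc (0 : ℝ) sbar → ℝ} (hm : Measurable φ) {C : ℝ}
    (hb : ∀ t, |φ t| ≤ C) (h : ¬ ∀ᵐ t ∂(Ψ : Measure (Set.Icc (0 : ℝ) sbar)), φ t = 0) :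
    0 < ∫ t, φ t ^ 2 ∂(Ψ : Measure (Set.Icc (0 : ℝ) sbar)) := by
  refine lt_of_le_of_ne (integral_nonneg fun _ => sq_nonneg _) fun h0 => h ?_
  have hi : Integrable (fun t => φ t ^ 2) (Ψ : Measure (Set.Icc (0 : ℝ) sbar)) :=
    Integrable.of_bound (hm.pow_const 2).aestronglyMeasurable (C ^ 2) (ae_of_all _ fun t => by
      rw [Real.norm_of_nonneg (sq_nonneg _), ← sq_abs]
      exact pow_le_pow_left₀ (abs_nonneg _) (hb t) 2)
  filter_upwards [(integral_eq_zero_iff_of_nonneg (fun _ => sq_nonneg _) hi).1 h0.symm] with t ht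
  exact pow_eq_zero_iff (two_ne_zero) |>.1 ht

theorem abs_coe_Icc_le {b : ℝ} (t : Set.Icc (0 : ℝ) b) : |(t : ℝ)| ≤ b := by
  rw [abs_of_nonneg t.2.1]; exact t.2.2

theorem tendsto_sum_sq_size (hΨ : Tendsto (sizeDist s) atTop (𝓝 Ψ))
    (hΨ0 : ¬ ∀ᵐ t : Set.Icc (0 : ℝ) sbar ∂(Ψ : Measure (Set.Icc (0 : ℝ) sbar)), (t : ℝ) = 0) :
    Tendsto (fun n => ∑ i ∈ Finset.range n, (s i : ℝ) ^ 2) atTop atTop := by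
  rw [← tendsto_add_atTop_iff_nat 1]
  have h1 := tendsto_average hΨ (φ := fun t => (t : ℝ) ^ 2) (by fun_prop)
    (ae_of_all _ fun t => by fun_prop) (C := sbar ^ 2) fun t => by
      rw [abs_pow]; exact pow_le_pow_left₀ (abs_nonneg _) (abs_coe_Icc_le t) 2
  have h2 : Tendsto (fun n : ℕ => ((n + 1 : ℕ) : ℝ)) atTop atTop :=
    tendsto_natCast_atTop_atTop.comp (tendsto_add_atTop_nat 1)
  refine (h1.pos_mul_atTop (integral_sq_pos (by fun_prop) abs_coe_Icc_le hΨ0) h2).congr fun n => ?_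
  rw [div_mul_cancel₀ _ (by positivity)]

theorem tendsto_cosine {abar : ℝ} (hΨ : Tendsto (sizeDist s) atTop (𝓝 Ψ))
    (hΨ0 : ¬ ∀ᵐ t : Set.Icc (0 : ℝ) sbar ∂(Ψ : Measure (Set.Icc (0 : ℝ) sbar)), (t : ℝ) = 0)
    {a : Set.Icc (0 : ℝ) sbar → Set.Icc (0 : ℝ) abar} (ha : Measurable a)
    (ha0 : ¬ ∀ᵐ t : Set.Icc (0 : ℝ) sbar ∂(Ψ : Measure (Set.Icc (0 : ℝ) sbar)), (a t : ℝ) = 0)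
    (hc : ∀ᵐ t : Set.Icc (0 : ℝ) sbar ∂(Ψ : Measure (Set.Icc (0 : ℝ) sbar)), ContinuousAt a t) :
    Tendsto (cosine s a) atTop (𝓝 (cosineIntegral Ψ a)) := by
  have ham : Measurable fun t => (a t : ℝ) := measurable_subtype_coe.comp ha
  have hac : ∀ᵐ t : Set.Icc (0 : ℝ) sbar ∂(Ψ : Measure (Set.Icc (0 : ℝ) sbar)),
      ContinuousAt (fun t => (a t : ℝ)) t :=
    hc.mono fun t ht => continuous_subtype_val.continuousAt.comp ht
  rw [← tendsto_add_atTop_iff_nat 1]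
  have hss := tendsto_average hΨ (φ := fun t => (t : ℝ) ^ 2) (by fun_prop)
    (ae_of_all _ fun t => by fun_prop) (C := sbar ^ 2) fun t => by
      rw [abs_pow]; exact pow_le_pow_left₀ (abs_nonneg _) (abs_coe_Icc_le t) 2
  have haa := tendsto_average hΨ (φ := fun t => (a t : ℝ) ^ 2) (by fun_prop)
    (hac.mono fun t ht => ht.pow 2) (C := abar ^ 2) fun t => by
      rw [abs_pow]; exact pow_le_pow_left₀ (abs_nonneg _) (abs_coe_Icc_le _) 2
  have hsa := tendsto_average hΨ (φ := fun t => (t : ℝ) * (a t : ℝ)) (by fun_prop)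
    (hac.mono fun t ht => continuous_subtype_val.continuousAt.mul ht) (C := sbar * abar)
    fun t => by
      rw [abs_mul]
      exact mul_le_mul (abs_coe_Icc_le _) (abs_coe_Icc_le _) (abs_nonneg _)
        ((abs_nonneg _).trans (abs_coe_Icc_le t))
  have hpos : √((∫ t, (t : ℝ) ^ 2 ∂(Ψ : Measure (Set.Icc (0 : ℝ) sbar))) *
      ∫ t, (a t : ℝ) ^ 2 ∂(Ψ : Measure (Set.Icc (0 : ℝ) sbar))) ≠ 0 :=
    (Real.sqrt_pos.2 (mul_pos (integral_sq_pos (by fun_prop) abs_coe_Icc_le hΨ0)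
      (integral_sq_pos ham (fun t => abs_coe_Icc_le (a t)) ha0))).ne'
  refine (hsa.div ((Real.continuous_sqrt.tendsto _).comp (hss.mul haa)) hpos).congr fun n => ?_
  have hn : (0 : ℝ) < ((n + 1 : ℕ) : ℝ) := by positivity
  simp only [Pi.div_apply, Function.comp_apply, cosine]
  rw [div_mul_div_comm, Real.sqrt_div' _ (by positivity), Real.sqrt_mul_self hn.le]
  exact div_div_div_cancel_right₀ hn.ne' _ _

end SizeDistribution

section Clamp

/-- The projection of the line onto `[-1, 1]`. -/
noncomputable def clamp (x : ℝ) : ℝ := max (-1) (min 1 x)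

theorem clamp_mem (x : ℝ) : clamp x ∈ Set.Icc (-1 : ℝ) 1 :=
  ⟨le_max_left _ _, max_le (by norm_num) (min_le_left _ _)⟩

theorem clamp_of_mem {x : ℝ} (hx : x ∈ Set.Icc (-1 : ℝ) 1) : clamp x = x := by
  rw [clamp, min_eq_right hx.2, max_eq_right hx.1]

theorem clamp_neg (x : ℝ) : clamp (-x) = -clamp x := by
  unfold clamp
  rcases le_total x 1 with h1 | h1 <;> rcases le_total (-1) x with h2 | h2
  · rw [min_eq_right h1, max_eq_right h2, min_eq_right (by linarith), max_eq_right (by linarith)]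
  · rw [min_eq_right h1, max_eq_left h2, min_eq_left (by linarith), max_eq_right (by linarith)]
    norm_num
  · rw [min_eq_left h1, max_eq_right (by norm_num : (-1 : ℝ) ≤ 1),
      min_eq_right (by linarith),
      max_eq_left (by linarith)]
  · linarith

theorem monotone_clamp : Monotone clamp := fun _ _ h => max_le_max le_rfl (min_le_min le_rfl h)

/-- A monotone odd rule on `[-1, 1]`, continued constantly outside. -/
theorem isRule_comp_clamp {r : ℝ → ℝ} (hr_maps : Set.MapsTo r (Set.Icc (-1) 1) (Set.Icc (-1) 1))
    (hr_mono : MonotoneOn r (Set.Icc (-1) 1)) (hr_odd : ∀ x ∈ Set.Icc (-1 : ℝ) 1, r (-x) = -r x) :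
    IsRule fun x => r (clamp x) where
  meas := Monotone.measurable fun _ _ h => hr_mono (clamp_mem _) (clamp_mem _) (monotone_clamp h)
  odd x := by rw [clamp_neg, hr_odd _ (clamp_mem x)]
  bound x := abs_le.2 (hr_maps (clamp_mem x))

theorem isRule_clamp : IsRule clamp :=
  isRule_comp_clamp (r := id) (Set.mapsTo_id _) (monotone_id.monotoneOn _) fun _ _ => rfl

end Clamp

end

/-! ### The three limits -/

theorem coin_abs_eq_one {Ω : Type*} [MeasurableSpace Ω] {P : Measure Ω} [IsProbabilityMeasure P]
    {L : Ω → ℝ} (hL : Measurable L) (h1 : P.real {ω | L ω = 1} = 1 / 2)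
    (h2 : P.real {ω | L ω = -1} = 1 / 2) : ∀ᵐ ω ∂P, |L ω| = 1 := by
  have hdis : Disjoint {ω | L ω = 1} {ω | L ω = -1} := by
    rw [Set.disjoint_left]
    intro ω h h'
    have h : L ω = 1 := h
    have h' : L ω = -1 := h'
    linarith
  have hu : P.real ({ω | L ω = 1} ∪ {ω | L ω = -1}) = 1 := by
    rw [measureReal_union hdis (measurableSet_eq_fun hL measurable_const), h1, h2]; norm_num
  have hmem : {ω | L ω = 1} ∪ {ω | L ω = -1} ∈ ae P := by
    rw [mem_ae_iff_prob_eq_one ((measurableSet_eq_fun hL measurable_const).union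
      (measurableSet_eq_fun hL measurable_const))]
    rw [measureReal_def] at hu
    exact (ENNReal.toReal_eq_one_iff _).1 hu
  filter_upwards [hmem] with ω hω
  rcases hω with h | h
  · rw [show L ω = 1 from h]; norm_num
  · rw [show L ω = -1 from h]; norm_num

end Apportion

theorem corollary2
    {Ω : Type*} [MeasurableSpace Ω] (P : Measure Ω) [IsProbabilityMeasure P]
    {sbar abar : ℝ}
    -- group sizes and their limiting distribution, not degenerate at zero
    (s : ℕ → Set.Icc (0 : ℝ) sbar)
    (Ψ : ProbabilityMeasure (Set.Icc (0 : ℝ) sbar))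
    (hΨ : Tendsto (Apportion.sizeDist s) atTop (𝓝 Ψ))
    (hΨ0 : ¬ ∀ᵐ t : Set.Icc (0 : ℝ) sbar ∂(Ψ : Measure (Set.Icc (0 : ℝ) sbar)), (t : ℝ) = 0)
    -- the rule: a nondecreasing odd nonzero function on [-1, 1] with values in [-1, 1]
    (r : ℝ → ℝ)
    (hr_maps : Set.MapsTo r (Set.Icc (-1) 1) (Set.Icc (-1) 1))
    (hr_mono : MonotoneOn r (Set.Icc (-1) 1))
    (hr_odd : ∀ x ∈ Set.Icc (-1 : ℝ) 1, r (-x) = -r x)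
    (hr_ne : ∃ x ∈ Set.Icc (-1 : ℝ) 1, r x ≠ 0)
    -- the vote margins: i.i.d., nondegenerate, symmetric about zero
    (X : ℕ → Ω → ℝ)
    (hX_meas : ∀ i, Measurable (X i))
    (hX_range : ∀ i ω, X i ω ∈ Set.Icc (-1 : ℝ) 1)
    (hX_indep : iIndepFun X P)
    (hX_ident : ∀ i, IdentDistrib (X i) (X 0) P P)
    (hX_symm : IdentDistrib (fun ω => -X 0 ω) (X 0) P P)
    (hX_nondeg : ¬ ∃ x : ℝ, ∀ᵐ ω ∂P, X 0 ω = x)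
    -- the fair tie-breaking coins, each independent of all the vote margins
    (L : ℕ → Ω → ℝ)
    (hL_meas : ∀ n, Measurable (L n))
    (hL_pos : ∀ n, P.real {ω | L n ω = 1} = 1 / 2)
    (hL_neg : ∀ n, P.real {ω | L n ω = -1} = 1 / 2)
    (hL_indep : ∀ n, IndepFun (L n) (fun ω i => X i ω) P)
    -- the weight allocation
    (a : Set.Icc (0 : ℝ) sbar → Set.Icc (0 : ℝ) abar)
    (ha_meas : Measurable a) :
    -- the three limits, in terms of the limit of cosine proportionality
    (∀ c : ℝ, Tendsto (Apportion.cosine s a) atTop (𝓝 c) →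
      Tendsto (Apportion.expectedWelfare P s a r X L) atTop
        (𝓝 (Real.sqrt (2 / Real.pi) * (Apportion.corr P r X * c))) ∧
      Tendsto (Apportion.meanMajorityDeficit P s a r X L) atTop
        (𝓝 ((1 - Apportion.corr P r X * c) / Real.sqrt (2 * Real.pi))) ∧
      Tendsto (Apportion.inversionProbability P s a r X L) atTop
        (𝓝 (Real.arccos (Apportion.corr P r X * c) / Real.pi))) ∧
    -- that limit is given by the integral formula
    ((¬ ∀ᵐ t : Set.Icc (0 : ℝ) sbar ∂(Ψ : Measure (Set.Icc (0 : ℝ) sbar)), (a t : ℝ) = 0) →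
      (∀ᵐ t : Set.Icc (0 : ℝ) sbar ∂(Ψ : Measure (Set.Icc (0 : ℝ) sbar)), ContinuousAt a t) →
      Tendsto (Apportion.cosine s a) atTop (𝓝 (Apportion.cosineIntegral Ψ a))) := by
  set f := Apportion.clamp with hf_def
  set g : ℝ → ℝ := fun x => r (Apportion.clamp x) with hg_def
  have hf : Apportion.IsRule f := Apportion.isRule_clamp
  have hg : Apportion.IsRule g := Apportion.isRule_comp_clamp hr_maps hr_mono hr_odd
  have hX : Apportion.IsMarginSeq P X := ⟨hX_meas, hX_range, hX_indep, hX_ident, hX_symm⟩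
  have hL : ∀ n, Apportion.IsCoin P X (L n) := fun n =>
    ⟨hL_meas n, Apportion.coin_abs_eq_one (hL_meas n) (hL_pos n) (hL_neg n), hL_indep n⟩
  have hfX : ∀ i ω, f (X i ω) = X i ω := fun i ω => Apportion.clamp_of_mem (hX_range i ω)
  have hgX : ∀ i ω, g (X i ω) = r (X i ω) := fun i ω => congrArg r (hfX i ω)
  have mff : Apportion.crossMoment P X f f = ∫ ω, X 0 ω ^ 2 ∂P := by
    simp only [Apportion.crossMoment, hfX, sq]
  have mgg : Apportion.crossMoment P X g g = ∫ ω, r (X 0 ω) ^ 2 ∂P := by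
    simp only [Apportion.crossMoment, hgX, sq]
  have mfg : Apportion.crossMoment P X f g = ∫ ω, X 0 ω * r (X 0 ω) ∂P := by
    simp only [Apportion.crossMoment, hfX, hgX]
  have hf0 : 0 < Apportion.crossMoment P X f f := by
    refine lt_of_le_of_ne (integral_nonneg fun _ => mul_self_nonneg _) fun h0 => hX_nondeg ⟨0, ?_⟩
    filter_upwards [(integral_eq_zero_iff_of_nonneg (fun _ => mul_self_nonneg _)
      (hX.integrable_mul hf hf 0)).1 h0.symm] with ω hω
    rw [← hfX 0 ω]
    exact mul_self_eq_zero.1 hω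
  set s' : ℕ → ℝ := fun i => (s i : ℝ) with hs'
  set a' : ℕ → ℝ := fun i => (a (s i) : ℝ) with ha'
  have hs := Apportion.tendsto_sum_sq_size hΨ hΨ0
  have hsb : ∀ i, |s' i| ≤ sbar := fun i => Apportion.abs_coe_Icc_le (s i)
  have hab : ∀ i, |a' i| ≤ abar := fun i => Apportion.abs_coe_Icc_le (a (s i))
  have ha0 : ∀ i, 0 ≤ a' i := fun i => (a (s i)).2.1
  have eS : ∀ n ω, Apportion.voteMargin s X n ω = Apportion.weightedSum s' f X n ω := fun n ω => by
    simp only [Apportion.voteMargin, Apportion.weightedSum, hfX, hs']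
  have eT : ∀ n ω, Apportion.weightMargin s a r X n ω = Apportion.weightedSum a' g X n ω :=
    fun n ω => by simp only [Apportion.weightMargin, Apportion.weightedSum, hgX, ha']
  have eσ : ∀ n, Apportion.voteSD P s X n = Apportion.weightedSD P s' f X n := fun n => by
    simp only [Apportion.voteSD, Apportion.weightedSD, mff, hs']
  have eD : ∀ n ω, Apportion.decision s a r X L n ω = Apportion.groupDecision a' g X (L n) n ω :=
    fun n ω => by
      simp only [Apportion.decision, Apportion.groupDecision, Apportion.tieSign, eT]
  have eW : ∀ n ω, Apportion.welfare P s a r X L n ω = Apportion.groupDecision a' g X (L n) n ω *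
      (Apportion.weightedSum s' f X n ω / Apportion.weightedSD P s' f X n) := fun n ω => by
    rw [Apportion.welfare, eD, eS, eσ, mul_div_assoc]
  -- `√` is multiplicative here as all factors are nonnegative; a vanishing denominator makes both
  -- sides `0`
  have eκ : ∀ n, Apportion.pairCorr P s' a' f g X n
      = Apportion.corr P r X * Apportion.cosine s a n := fun n => by
    have hff := hf0.le
    have hgg : 0 ≤ Apportion.crossMoment P X g g := integral_nonneg fun _ => mul_self_nonneg _
    have hss : 0 ≤ ∑ i ∈ Finset.range n, s' i ^ 2 := Finset.sum_nonneg fun _ _ => sq_nonneg _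
    rw [Apportion.corr, Apportion.cosine, div_mul_div_comm, ← mff, ← mgg, ← mfg,
      Apportion.pairCorr, Apportion.weightedSD, Apportion.weightedSD, Real.sqrt_mul hff,
      Real.sqrt_mul hgg, Real.sqrt_mul hff, Real.sqrt_mul hss, mul_mul_mul_comm]
  refine ⟨fun c hc => ?_, fun ha_ne ha_cont =>
    Apportion.tendsto_cosine hΨ hΨ0 ha_meas ha_ne ha_cont⟩
  have hκ : Tendsto (Apportion.pairCorr P s' a' f g X) atTop (𝓝 (Apportion.corr P r X * c)) :=
    (hc.const_mul _).congr fun n => (eκ n).symm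
  obtain ⟨hu, hp⟩ := Apportion.tendsto_welfare_and_inversion hX hf hg hL hf0 hsb hab ha0 hs hκ
  refine ⟨hu.congr fun n => ?_, (Apportion.tendsto_deficit hX hf hg hL hf0 hsb hs hu).congr
    fun n => ?_, hp.congr fun n => ?_⟩
  · simp only [Apportion.expectedWelfare, eW]
  · simp only [Apportion.meanMajorityDeficit, eW, eS, eσ]
  · simp only [Apportion.inversionProbability, eW]
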